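/- All manifolds are smooth, finite-dimensional, Hausdorff and without boundary. Let $(B,\omega_B)$ be a compact symplectic manifold and let $(N,\omega_N)$ be a (possibly non-compact) symplectic manifold with a proper continuous (for instance, smooth and proper) height function $H\colon N\to[0,\infty)$. Let $\pi\colon M\to B$ be a proper symplectic bundle with fibre $N$, that is, a smooth fibre bundle given by local trivializations $\phi_\alpha\colon U_\alpha\times N\to\pi^{-1}(U_\alpha)$ whose transition functions take values in $$\operatorname{Sympl}(N,\omega_N,H)=\{f\colon N\to N \text{ a diffeomorphism}\mid f^*\omega_N=\omega_N,\ H\circ f=H\}.$$ For $x\in U_\alpha$ the diffeomorphism $\phi_\alpha(x,\cdot)\colon N\to N_x:=\pi^{-1}(x)$ transports $\omega_N$ to a symplectic form on $N_x$ that does not depend on $\alpha$, and is again denoted by $\omega_N$; likewise, $H$ induces a function $H_M\colon M\to[0,\infty)$ with $H_M(\phi_\alpha(x,p))=H(p)$. Suppose that there is a de Rham cohomology class $e\in H^2(M,\mathbb R)$ whose restriction to every fibre $N_x$ is $[\omega_N]\in H^2(N_x,\mathbb R)$. Then for every $R>0$ there is a closed smooth $2$-form $\omega_M$ on $M$ such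 that $\omega_M|_{N_x}=\omega_N$ for every $x\in B$, and $\omega_M$ is non-degenerate at every point of $M_R:=H_M^{-1}([0,R])$. -/

import Mathlib

open scoped Manifold ContDiff NNReal

noncomputable section

namespace DiffForm

variable {E M : Type*} [NormedAddCommGroup E] [NormedSpace ℝ E]
  [TopologicalSpace M] [ChartedSpace E M] {k : ℕ}

/-- Not necessarily smooth differential `k`-forms on the manifold `M` modelled on `E`. -/
def FormSection (E M : Type*) [NormedAddCommGroup E] [NormedSpace ℝ E]
    [TopologicalSpace M] [ChartedSpace E M] (k : ℕ) : Type _ :=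
  ∀ x : M, TangentSpace 𝓘(ℝ, E) x [⋀^Fin k]→L[ℝ] ℝ

instance : AddCommGroup (FormSection E M k) :=
  inferInstanceAs (AddCommGroup (∀ x : M, TangentSpace 𝓘(ℝ, E) x [⋀^Fin k]→L[ℝ] ℝ))

instance : Module ℝ (FormSection E M k) :=
  inferInstanceAs (Module ℝ (∀ x : M, TangentSpace 𝓘(ℝ, E) x [⋀^Fin k]→L[ℝ] ℝ))

/-- The form `α` in the preferred chart `φ` at `x₀`: the pullback of `α` along `φ⁻¹`, a form on `E`
that is meaningful on the target of `φ`. -/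
def inChart (α : FormSection E M k) (x₀ : M) (y : E) : E [⋀^Fin k]→L[ℝ] ℝ :=
  (α ((extChartAt 𝓘(ℝ, E) x₀).symm y)).compContinuousLinearMap
    (mfderiv 𝓘(ℝ, E) 𝓘(ℝ, E) (extChartAt 𝓘(ℝ, E) x₀).symm y)

/-- The exterior derivative, computed at `x` in the preferred chart `φ` at `x`:
`(dα)_x = φ^* d((φ⁻¹)^* α)`. -/
def extD (α : FormSection E M k) : FormSection E M (k + 1) := fun x =>
  (extDeriv (inChart α x) (extChartAt 𝓘(ℝ, E) x x)).compContinuousLinearMap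
    (mfderiv 𝓘(ℝ, E) 𝓘(ℝ, E) (extChartAt 𝓘(ℝ, E) x) x)

theorem inChart_add (α η : FormSection E M k) (x₀ : M) :
    inChart (α + η) x₀ = inChart α x₀ + inChart η x₀ := rfl

theorem inChart_smul (c : ℝ) (α : FormSection E M k) (x₀ : M) :
    inChart (c • α) x₀ = c • inChart α x₀ := rfl

/-- The smooth `k`-forms on `M`: the coefficients in every preferred chart are smooth. -/
def smoothForms (E M : Type*) [NormedAddCommGroup E] [NormedSpace ℝ E]
    [TopologicalSpace M] [ChartedSpace E M] (k : ℕ) : Submodule ℝ (FormSection E M k) where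
  carrier := {α | ∀ x₀, ContDiffOn ℝ ∞ (inChart α x₀) (extChartAt 𝓘(ℝ, E) x₀).target}
  zero_mem' := fun _ => contDiffOn_const (c := 0)
  add_mem' := fun ha hb x₀ => (ha x₀).add (hb x₀)
  smul_mem' := fun c _ h x₀ => (h x₀).const_smul c

theorem contDiffAt_inChart {α : FormSection E M k} (hα : α ∈ smoothForms E M k) (x₀ : M) {y : E}
    (hy : y ∈ (extChartAt 𝓘(ℝ, E) x₀).target) : ContDiffAt ℝ ∞ (inChart α x₀) y :=
  (show ContDiffOn _ _ _ _ from hα x₀).contDiffAt ((isOpen_extChartAt_target x₀).mem_nhds hy)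

theorem differentiableAt_inChart {α : FormSection E M k} (hα : α ∈ smoothForms E M k) (x : M) :
    DifferentiableAt ℝ (inChart α x) (extChartAt 𝓘(ℝ, E) x x) :=
  (contDiffAt_inChart hα x (mem_extChartAt_target x)).differentiableAt (by simp)

/-- The exterior derivative on smooth forms, as a linear map. -/
def d : smoothForms E M k →ₗ[ℝ] FormSection E M (k + 1) where
  toFun α := extD α.1
  map_add' α η := by
    funext x
    simp only [extD, Submodule.coe_add, inChart_add]
    rw [extDeriv_add (differentiableAt_inChart α.2 x) (differentiableAt_inChart η.2 x)]
    rfl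
  map_smul' c α := by
    funext x
    simp only [extD, Submodule.coe_smul, inChart_smul]
    rw [extDeriv_smul]
    rfl

/-- Closed smooth `k`-forms. -/
def closedForms (E M : Type*) [NormedAddCommGroup E] [NormedSpace ℝ E]
    [TopologicalSpace M] [ChartedSpace E M] (k : ℕ) : Submodule ℝ (smoothForms E M k) :=
  LinearMap.ker d

/-- Exact smooth `k`-forms: `α = dθ` with `θ` a smooth `(k-1)`-form. -/
def exactForms (E M : Type*) [NormedAddCommGroup E] [NormedSpace ℝ E]
    [TopologicalSpace M] [ChartedSpace E M] : (k : ℕ) → Submodule ℝ (smoothForms E M k)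
  | 0 => ⊥
  | _ + 1 => (LinearMap.range d).comap (smoothForms E M _).subtype

/-- The de Rham cohomology space `Hᵏ(M) = {closed k-forms} / {exact k-forms}`. -/
abbrev DeRham (E M : Type*) [NormedAddCommGroup E] [NormedSpace ℝ E]
    [TopologicalSpace M] [ChartedSpace E M] (k : ℕ) : Type _ :=
  closedForms E M k ⧸ (exactForms E M k).comap (closedForms E M k).subtype

variable {E' M' : Type*} [NormedAddCommGroup E'] [NormedSpace ℝ E']
  [TopologicalSpace M'] [ChartedSpace E' M']

/-- Pullback of a `k`-form: `(f^* α)_x = α_{f x} ∘ (df_x × ⋯ × df_x)`. -/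
def pull (f : M → M') (α : FormSection E' M' k) : FormSection E M k := fun x =>
  (α (f x)).compContinuousLinearMap (mfderiv 𝓘(ℝ, E) 𝓘(ℝ, E') f x)

/-- Antisymmetrisation, normalised to be a left inverse of the inclusion of alternating maps. -/
theorem exists_leftInverse (E : Type*) [NormedAddCommGroup E] [NormedSpace ℝ E] (k : ℕ) :
    ∃ P : ContinuousMultilinearMap ℝ (fun _ : Fin k => E) ℝ →L[ℝ] (E [⋀^Fin k]→L[ℝ] ℝ),
      ∀ a : E [⋀^Fin k]→L[ℝ] ℝ, P a.toContinuousMultilinearMap = a := by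
  have hk : (k.factorial : ℝ) ≠ 0 := by exact_mod_cast k.factorial_ne_zero
  let A : ContinuousMultilinearMap ℝ (fun _ : Fin k => E) ℝ →ₗ[ℝ] (E [⋀^Fin k]→L[ℝ] ℝ) :=
    { toFun := fun m => ((k.factorial : ℝ)⁻¹) • ContinuousMultilinearMap.alternatization m
      map_add' := fun m n => by simp
      map_smul' := fun c m => by
        ext v
        simp only [ContinuousAlternatingMap.smul_apply,
          ContinuousMultilinearMap.alternatization_apply_apply, smul_eq_mul, Finset.mul_sum,
          RingHom.id_apply, smul_apply]
        refine Finset.sum_congr rfl fun σ _ => ?_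
        simp only [Units.smul_def, zsmul_eq_mul]
        ring }
  have hA : ∀ m v, A m v = ((k.factorial : ℝ)⁻¹) *
      ∑ σ : Equiv.Perm (Fin k), Equiv.Perm.sign σ • m (v ∘ σ) := fun m v => by
    simp [A, ContinuousMultilinearMap.alternatization_apply_apply]
  refine ⟨A.mkContinuous 1 fun m => ?_, fun a => ?_⟩
  · refine ContinuousAlternatingMap.opNorm_le_bound _ (by positivity) fun v => ?_
    rw [hA, norm_mul, one_mul]
    have h : ‖∑ σ : Equiv.Perm (Fin k), Equiv.Perm.sign σ • m (v ∘ σ)‖ ≤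
        ∑ _σ : Equiv.Perm (Fin k), ‖m‖ * ∏ i, ‖v i‖ := by
      refine norm_sum_le_of_le _ fun σ _ => ?_
      have h1 : ‖Equiv.Perm.sign σ • m (v ∘ σ)‖ = ‖m (v ∘ σ)‖ := by
        rcases Int.units_eq_one_or (Equiv.Perm.sign σ) with h | h <;> simp [h]
      rw [h1]
      refine (m.le_opNorm _).trans_eq ?_
      congr 1
      exact Equiv.prod_comp σ (fun i => ‖v i‖)
    rw [Finset.sum_const, Finset.card_univ, Fintype.card_perm, Fintype.card_fin,
      nsmul_eq_mul] at h
    calc _ ≤ ‖((k.factorial : ℝ)⁻¹)‖ * (k.factorial * (‖m‖ * ∏ i, ‖v i‖)) := by gcongr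
      _ = _ := by simp [hk]
  · ext v
    rw [LinearMap.mkContinuous_apply, hA]
    have h : ∀ σ : Equiv.Perm (Fin k),
        Equiv.Perm.sign σ • a.toContinuousMultilinearMap (v ∘ σ) = a v := fun σ => by
      have := a.toAlternatingMap.map_perm v σ
      change Equiv.Perm.sign σ • a.toAlternatingMap (v ∘ σ) = a v
      rw [this, smul_smul, Int.units_mul_self, one_smul]
      rfl
    rw [Finset.sum_congr rfl fun σ _ => h σ]
    simp [Fintype.card_perm, hk]

theorem contDiff_compCLM : ContDiff ℝ ∞ (fun p : (E' [⋀^Fin k]→L[ℝ] ℝ) × (E →L[ℝ] E') =>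
    p.1.compContinuousLinearMap p.2) := by
  obtain ⟨P, hP⟩ := exists_leftInverse E k
  have h1 : ContDiff ℝ ∞ (fun p : (E' [⋀^Fin k]→L[ℝ] ℝ) × (E →L[ℝ] E') =>
      ContinuousMultilinearMap.compContinuousLinearMapContinuousMultilinear ℝ
        (fun _ : Fin k => E) (fun _ : Fin k => E') ℝ (fun _ => p.2)) :=
    (ContinuousMultilinearMap.contDiff _).comp (contDiff_pi.2 fun _ => contDiff_snd)
  have h2 : ContDiff ℝ ∞ (fun p : (E' [⋀^Fin k]→L[ℝ] ℝ) × (E →L[ℝ] E') =>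
      ContinuousAlternatingMap.toContinuousMultilinearMapCLM ℝ p.1) :=
    (ContinuousLinearMap.contDiff _).comp contDiff_fst
  have h3 := P.contDiff.comp (h1.clm_apply h2)
  have h4 : (fun p : (E' [⋀^Fin k]→L[ℝ] ℝ) × (E →L[ℝ] E') =>
      p.1.compContinuousLinearMap p.2) = P ∘ fun p =>
        (ContinuousMultilinearMap.compContinuousLinearMapContinuousMultilinear ℝ
          (fun _ : Fin k => E) (fun _ : Fin k => E') ℝ (fun _ => p.2))
        (ContinuousAlternatingMap.toContinuousMultilinearMapCLM ℝ p.1) :=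
    funext fun p => (hP (p.1.compContinuousLinearMap p.2)).symm
  rw [h4]
  exact h3
 
theorem pull_congr {f g : M → M'} (α : FormSection E' M' k) {x : M} (h : f =ᶠ[nhds x] g) :
    (pull f α : FormSection E M k) x = (pull g α : FormSection E M k) x := by
  have h1 : (mfderiv 𝓘(ℝ, E) 𝓘(ℝ, E') f x : E →L[ℝ] E') = mfderiv 𝓘(ℝ, E) 𝓘(ℝ, E') g x :=
    h.mfderiv_eq
  let α' : M' → E' [⋀^Fin k]→L[ℝ] ℝ := fun p => α p
  have h2 : α' (f x) = α' (g x) := congrArg α' h.self_of_nhds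
  change ContinuousAlternatingMap.compContinuousLinearMap (α' (f x))
    (mfderiv 𝓘(ℝ, E) 𝓘(ℝ, E') f x : E →L[ℝ] E') = _
  rw [h1, h2]
  rfl

theorem pull_pull {E₁ M₁ : Type*} [NormedAddCommGroup E₁] [NormedSpace ℝ E₁]
    [TopologicalSpace M₁] [ChartedSpace E₁ M₁] {f : M → M'} {g : M₁ → M}
    (α : FormSection E' M' k) {x : M₁} (hf : MDifferentiableAt 𝓘(ℝ, E) 𝓘(ℝ, E') f (g x))
    (hg : MDifferentiableAt 𝓘(ℝ, E₁) 𝓘(ℝ, E) g x) :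
    (pull g (pull f α : FormSection E M k) : FormSection E₁ M₁ k) x =
      (pull (f ∘ g) α : FormSection E₁ M₁ k) x := by
  simp only [pull]
  rw [mfderiv_comp x hf hg]
  rfl

variable [IsManifold 𝓘(ℝ, E) ∞ M] [IsManifold 𝓘(ℝ, E') ∞ M']

theorem inChart_pull {f : M → M'} (hf : ContMDiff 𝓘(ℝ, E) 𝓘(ℝ, E') ∞ f) (α : FormSection E' M' k)
    (x₀ : M) {y : E} (hy : y ∈ (extChartAt 𝓘(ℝ, E) x₀).target) (q : M')
    (hq : f ((extChartAt 𝓘(ℝ, E) x₀).symm y) ∈ (extChartAt 𝓘(ℝ, E') q).source) :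
    ContDiffAt ℝ ∞ (extChartAt 𝓘(ℝ, E') q ∘ f ∘ (extChartAt 𝓘(ℝ, E) x₀).symm) y ∧
    inChart (pull f α) x₀ =ᶠ[nhds y] fun z =>
      (inChart α q
        ((extChartAt 𝓘(ℝ, E') q ∘ f ∘ (extChartAt 𝓘(ℝ, E) x₀).symm) z)).compContinuousLinearMap
        (fderiv ℝ (extChartAt 𝓘(ℝ, E') q ∘ f ∘ (extChartAt 𝓘(ℝ, E) x₀).symm) z) := by
  have key : ∀ z ∈ (extChartAt 𝓘(ℝ, E) x₀).target,
      f ((extChartAt 𝓘(ℝ, E) x₀).symm z) ∈ (extChartAt 𝓘(ℝ, E') q).source →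
      ContMDiffAt 𝓘(ℝ, E) 𝓘(ℝ, E') ∞ (f ∘ (extChartAt 𝓘(ℝ, E) x₀).symm) z := fun z hz hzq =>
    hf.contMDiffAt.comp z ((contMDiffOn_extChartAt_symm x₀).contMDiffAt
      ((isOpen_extChartAt_target x₀).mem_nhds hz))
  have key2 : ∀ z ∈ (extChartAt 𝓘(ℝ, E) x₀).target,
      f ((extChartAt 𝓘(ℝ, E) x₀).symm z) ∈ (extChartAt 𝓘(ℝ, E') q).source →
      ContMDiffAt 𝓘(ℝ, E) 𝓘(ℝ, E') ∞
        (extChartAt 𝓘(ℝ, E') q ∘ f ∘ (extChartAt 𝓘(ℝ, E) x₀).symm) z := fun z hz hzq =>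
    (contMDiffAt_extChartAt' (by simpa using hzq)).comp z (key z hz hzq)
  refine ⟨(key2 y hy hq).contDiffAt, ?_⟩
  have hev : ∀ᶠ z in nhds y, z ∈ (extChartAt 𝓘(ℝ, E) x₀).target ∧
      f ((extChartAt 𝓘(ℝ, E) x₀).symm z) ∈ (extChartAt 𝓘(ℝ, E') q).source :=
    ((isOpen_extChartAt_target (I := 𝓘(ℝ, E)) x₀).eventually_mem hy).and
      ((key y hy hq).continuousAt.preimage_mem_nhds ((isOpen_extChartAt_source q).mem_nhds hq))
  filter_upwards [hev] with z hz
  have hF := (key2 z hz.1 hz.2).mdifferentiableAt (by simp)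
  have hψ : MDifferentiableAt 𝓘(ℝ, E) 𝓘(ℝ, E) (extChartAt 𝓘(ℝ, E) x₀).symm z :=
    ((contMDiffOn_extChartAt_symm (n := ∞) x₀).contMDiffAt
      ((isOpen_extChartAt_target x₀).mem_nhds hz.1)).mdifferentiableAt (by simp)
  have hχ : MDifferentiableAt 𝓘(ℝ, E') 𝓘(ℝ, E') (extChartAt 𝓘(ℝ, E') q).symm
      ((extChartAt 𝓘(ℝ, E') q ∘ f ∘ (extChartAt 𝓘(ℝ, E) x₀).symm) z) :=
    ((contMDiffOn_extChartAt_symm (n := ∞) q).contMDiffAt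
      ((isOpen_extChartAt_target q).mem_nhds
        ((extChartAt 𝓘(ℝ, E') q).map_source hz.2))).mdifferentiableAt (by simp)
  have e1 := pull_pull (k := k) α (hf.mdifferentiable (by simp) _) hψ
  have e2 := pull_pull (k := k) α hχ hF
  have e3 : (f ∘ (extChartAt 𝓘(ℝ, E) x₀).symm) =ᶠ[nhds z]
      ((extChartAt 𝓘(ℝ, E') q).symm ∘ extChartAt 𝓘(ℝ, E') q ∘ f ∘
        (extChartAt 𝓘(ℝ, E) x₀).symm) := by
    filter_upwards [(key z hz.1 hz.2).continuousAt.preimage_mem_nhds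
      ((isOpen_extChartAt_source q).mem_nhds hz.2)] with w hw
    exact ((extChartAt 𝓘(ℝ, E') q).left_inv hw).symm
  have e4 := (e1.trans (pull_congr α e3)).trans e2.symm
  rw [← mfderiv_eq_fderiv]
  exact e4

theorem pull_mem {f : M → M'} (hf : ContMDiff 𝓘(ℝ, E) 𝓘(ℝ, E') ∞ f) {α : FormSection E' M' k}
    (hα : α ∈ smoothForms E' M' k) : pull f α ∈ smoothForms E M k := by
  intro x₀ y hy
  obtain ⟨h1, h2⟩ := inChart_pull hf α x₀ hy (f ((extChartAt 𝓘(ℝ, E) x₀).symm y))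
    (mem_extChartAt_source _)
  refine ContDiffAt.contDiffWithinAt (ContDiffAt.congr_of_eventuallyEq ?_ h2)
  refine contDiff_compCLM.contDiffAt.comp y (ContDiffAt.prodMk ?_ (h1.fderiv_right (by simp)))
  exact (contDiffAt_inChart hα _ (mem_extChartAt_target _)).comp y h1

theorem extD_pull {f : M → M'} (hf : ContMDiff 𝓘(ℝ, E) 𝓘(ℝ, E') ∞ f) {α : FormSection E' M' k}
    (hα : α ∈ smoothForms E' M' k) : extD (pull f α : FormSection E M k) = pull f (extD α) := by
  funext x
  obtain ⟨h1, h2⟩ := inChart_pull hf α x (mem_extChartAt_target x) (f x) (by simp)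
  have hq : (extChartAt 𝓘(ℝ, E') (f x) ∘ f ∘ (extChartAt 𝓘(ℝ, E) x).symm)
      (extChartAt 𝓘(ℝ, E) x x) = extChartAt 𝓘(ℝ, E') (f x) (f x) := by simp
  have hd : DifferentiableAt ℝ (inChart α (f x))
      ((extChartAt 𝓘(ℝ, E') (f x) ∘ f ∘ (extChartAt 𝓘(ℝ, E) x).symm)
        (extChartAt 𝓘(ℝ, E) x x)) := by
    rw [hq]
    exact differentiableAt_inChart hα (f x)
  have hφ : MDifferentiableAt 𝓘(ℝ, E) 𝓘(ℝ, E) (extChartAt 𝓘(ℝ, E) x) x :=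
    mdifferentiableAt_extChartAt (mem_chart_source E x)
  have hχ : MDifferentiableAt 𝓘(ℝ, E') 𝓘(ℝ, E') (extChartAt 𝓘(ℝ, E') (f x)) (f x) :=
    mdifferentiableAt_extChartAt (mem_chart_source E' (f x))
  let β₀ : E' → E' [⋀^Fin (k + 1)]→L[ℝ] ℝ := extDeriv (inChart α (f x))
  let β : FormSection E' E' (k + 1) := β₀
  have e1 := pull_pull (k := k + 1) β (h1.differentiableAt (by simp)).mdifferentiableAt hφ
  have e2 := pull_pull (k := k + 1) β hχ (hf.mdifferentiable (by simp) x)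
  have e3 : ((extChartAt 𝓘(ℝ, E') (f x) ∘ f ∘ (extChartAt 𝓘(ℝ, E) x).symm) ∘
      extChartAt 𝓘(ℝ, E) x) =ᶠ[nhds x] (extChartAt 𝓘(ℝ, E') (f x) ∘ f) := by
    filter_upwards [(isOpen_extChartAt_source (I := 𝓘(ℝ, E)) x).mem_nhds
      (mem_extChartAt_source x)] with w hw
    simp only [Function.comp_apply]
    rw [(extChartAt 𝓘(ℝ, E) x).left_inv hw]
  have e4 := (e1.trans (pull_congr β e3)).trans e2.symm
  have e5 := extDeriv_pullback (r := ∞) hd h1 (by simpa using ENat.LEInfty.out)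
  have e6 := h2.extDeriv_eq.trans e5
  rw [← mfderiv_eq_fderiv] at e6
  change ContinuousAlternatingMap.compContinuousLinearMap
    (extDeriv (inChart (pull f α : FormSection E M k) x) (extChartAt 𝓘(ℝ, E) x x)) _ = _
  rw [e6]
  exact e4

/-- Pullback of smooth `k`-forms along a smooth map, as a linear map. -/
def pullback (f : C^∞⟮𝓘(ℝ, E), M; 𝓘(ℝ, E'), M'⟯) :
    smoothForms E' M' k →ₗ[ℝ] smoothForms E M k where
  toFun α := ⟨pull f α.1, pull_mem f.contMDiff α.2⟩
  map_add' _ _ := rfl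
  map_smul' _ _ := rfl

theorem d_pullback (f : C^∞⟮𝓘(ℝ, E), M; 𝓘(ℝ, E'), M'⟯) (α : smoothForms E' M' k) :
    d (pullback f α) = pull f (d α) :=
  extD_pull f.contMDiff α.2

theorem pullback_mem_closedForms (f : C^∞⟮𝓘(ℝ, E), M; 𝓘(ℝ, E'), M'⟯)
    (α : smoothForms E' M' k) (hα : α ∈ closedForms E' M' k) :
    pullback f α ∈ closedForms E M k := by
  have h : d α = 0 := hα
  change d (pullback f α) = 0
  rw [d_pullback, h]
  rfl

theorem pullback_mem_exactForms (f : C^∞⟮𝓘(ℝ, E), M; 𝓘(ℝ, E'), M'⟯) :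
    ∀ {k : ℕ} (α : smoothForms E' M' k), α ∈ exactForms E' M' k →
      pullback f α ∈ exactForms E M k
  | 0, α, hα => by
    have h : α = 0 := hα
    rw [h, map_zero]
    exact zero_mem _
  | k + 1, α, hα => by
    obtain ⟨θ, hθ⟩ : ∃ θ, d θ = α.1 := hα
    refine ⟨pullback f θ, ?_⟩
    rw [d_pullback, hθ]
    rfl

/-- Pullback of closed forms. -/
def pullbackClosed (k : ℕ) (f : C^∞⟮𝓘(ℝ, E), M; 𝓘(ℝ, E'), M'⟯) :
    closedForms E' M' k →ₗ[ℝ] closedForms E M k :=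
  (pullback f).restrict (pullback_mem_closedForms f)

/-- The map induced in de Rham cohomology by a smooth map. -/
def cohomologyMap (k : ℕ) (f : C^∞⟮𝓘(ℝ, E), M; 𝓘(ℝ, E'), M'⟯) :
    DeRham E' M' k →ₗ[ℝ] DeRham E M k :=
  Submodule.mapQ _ _ (pullbackClosed k f) fun α hα => pullback_mem_exactForms f α.1 hα

/-- The 2-form `α` is non-degenerate at `x`: only the zero tangent vector pairs to zero with
every tangent vector at `x`. -/
def NondegenerateAt (α : FormSection E M 2) (x : M) : Prop :=
  ∀ u : TangentSpace 𝓘(ℝ, E) x, (∀ v : TangentSpace 𝓘(ℝ, E) x, α x ![u, v] = 0) → u = 0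

/-- Symplectic forms: closed smooth 2-forms that are non-degenerate at every point. -/
structure IsSymplectic (α : smoothForms E M 2) : Prop where
  closed : α ∈ closedForms E M 2
  nondegenerate : ∀ x : M, NondegenerateAt α.1 x

/-- The class `[α] ∈ H²(M)` of a symplectic form. -/
def IsSymplectic.cohomologyClass {α : smoothForms E M 2} (h : IsSymplectic α) : DeRham E M 2 :=
  Submodule.Quotient.mk ⟨α, h.closed⟩

end DiffForm

open DiffForm

section

variable {EB EN EM B N M : Type*}
  [NormedAddCommGroup EB] [NormedSpace ℝ EB] [NormedAddCommGroup EN] [NormedSpace ℝ EN]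
  [NormedAddCommGroup EM] [NormedSpace ℝ EM]
  [TopologicalSpace B] [ChartedSpace EB B] [TopologicalSpace N] [ChartedSpace EN N]
  [TopologicalSpace M] [ChartedSpace EM M]

/-- The group of symplectic diffeomorphisms of `(N, ωN)` that preserve the function `H`. -/
def Sympl (ωN : smoothForms EN N 2) (H : N → ℝ≥0) :
    Set (Diffeomorph 𝓘(ℝ, EN) 𝓘(ℝ, EN) N N ∞) :=
  {f | pull f ωN.1 = ωN.1 ∧ H ∘ f = H}

/-- The structure of a smooth fibre bundle with fibre `N` on `π : M → B`, given by smooth local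
trivialisations whose transition functions take values in `Sympl ωN H`. -/
structure SymplecticBundle (π : M → B) (ωN : smoothForms EN N 2) (H : N → ℝ≥0) where
  atlas : Set (Bundle.Trivialization N π)
  exists_mem : ∀ x : B, ∃ e ∈ atlas, x ∈ e.baseSet
  contMDiffOn : ∀ e ∈ atlas,
    ContMDiffOn 𝓘(ℝ, EM) (𝓘(ℝ, EB).prod 𝓘(ℝ, EN)) ∞ e e.source
  contMDiffOn_symm : ∀ e ∈ atlas,
    ContMDiffOn (𝓘(ℝ, EB).prod 𝓘(ℝ, EN)) 𝓘(ℝ, EM) ∞ e.toOpenPartialHomeomorph.symm e.target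
  coordChange_mem : ∀ e ∈ atlas, ∀ e' ∈ atlas, ∀ x ∈ e.baseSet ∩ e'.baseSet,
    ∃ g ∈ Sympl ωN H, ⇑g = e.coordChange e' x

namespace SymplecticBundle

variable {π : M → B} {ωN : smoothForms EN N 2} {H : N → ℝ≥0}

/-- For a trivialisation `e` in the atlas and `x` in its base set, the embedding `N → M`,
`p ↦ e⁻¹ (x, p)`, which identifies `N` with the fibre over `x`. -/
def fibreMap (P : SymplecticBundle (EB := EB) (EM := EM) π ωN H) {e : Bundle.Trivialization N π}
    (he : e ∈ P.atlas) {x : B} (hx : x ∈ e.baseSet) : C^∞⟮𝓘(ℝ, EN), N; 𝓘(ℝ, EM), M⟯ :=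
  ⟨fun p => e.toOpenPartialHomeomorph.symm (x, p),
    (P.contMDiffOn_symm e he).comp_contMDiff (contMDiff_const.prodMk contMDiff_id)
      fun _ => e.mem_target.2 hx⟩

/-- The height function `H_M` on the total space: `H` of the fibre coordinate in any
trivialisation of the atlas, see `height_eq`. -/
def height (P : SymplecticBundle (EB := EB) (EM := EM) π ωN H) (y : M) : ℝ≥0 :=
  H ((P.exists_mem (π y)).choose y).2

theorem height_eq (P : SymplecticBundle (EB := EB) (EM := EM) π ωN H) {e : Bundle.Trivialization N π}
    (he : e ∈ P.atlas) {y : M} (hy : π y ∈ e.baseSet) : P.height y = H (e y).2 := by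
  obtain ⟨h₁, h₂⟩ := (P.exists_mem (π y)).choose_spec
  obtain ⟨g, hg, hge⟩ := P.coordChange_mem e he _ h₁ (π y) ⟨hy, h₂⟩
  have h₃ := congrFun hg.2 (e y).2
  rw [Function.comp_apply, hge, e.coordChange_apply_snd _ hy] at h₃
  exact h₃

/-- The region `M_R = H_M⁻¹([0, R])` of the total space. -/
def sublevel (P : SymplecticBundle (EB := EB) (EM := EM) π ωN H) (R : ℝ) : Set M :=
  {y | (P.height y : ℝ) ≤ R}

end SymplecticBundle

end

end

/-! This is Thurston's construction. Let `η` be a closed form representing `e`. Over a small chart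
ball `W` around `b` in the base, contracting `W` to `b` shows by the homotopy formula
(`extD_homotopyForm`) that `η` differs by an exact form from the pullback, along the fibre
coordinate of a trivialisation, of `η` restricted to the fibre over `b`. By hypothesis that
restriction is `ωN + dθ`. Hence over `W` the form `η` equals the pullback of `ωN` plus `dλ`
(`exists_local_primitive`).

Take a partition of unity `ρ i` on `B` subordinate to finitely many such sets and put `α = η - ∑
d((ρ i ∘ π) λ i)`. This is closed. On the fibre over `x` each `ρ i ∘ π` is constant, so the sum
restricts to `∑ ρ i x • (η - ωN) = η - ωN`, and `α` restricts to `ωN` (`exists_closed_extension`).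
The transition maps preserve `ωN`, so it does not matter which trivialisation is used.

Finally `α + K • π^* ωB` is closed and has the same fibre restrictions, since `π` is constant on
fibres. For large `K` it is non-degenerate: `ωN` controls the vertical directions and `K • ωB` the
horizontal ones (`nondegenerateForm_add_smul`). The threshold for `K` is locally uniform. As `B` is
compact and `H` is proper, `M_R` lies in a compact set (`exists_isCompact_sublevel_subset`), so one
`K` serves. -/

noncomputable section

/-! ### Smoothness of integrals over `[0, 1]` depending on a parameter. -/

section ParametricIntegral

universe u

open MeasureTheory

variable {E F : Type u} [NormedAddCommGroup E] [NormedSpace ℝ E]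
  [NormedAddCommGroup F] [NormedSpace ℝ F] {f : ℝ × E → F} {U : Set E}

theorem continuous_slice {X Y : Type*} [TopologicalSpace X] [TopologicalSpace Y] {f : ℝ × X → Y}
    {U : Set X} (hf : ContinuousOn f (Set.univ ×ˢ U)) {z : X} (hz : z ∈ U) :
    Continuous fun t : ℝ => f (t, z) :=
  continuousOn_univ.1 (hf.comp (by fun_prop) fun t _ => ⟨Set.mem_univ t, hz⟩)

/-- Differentiation under the integral sign for `C¹` integrands. -/
theorem hasFDerivAt_integral_slice (hU : IsOpen U) (hf : ContDiffOn ℝ 1 f (Set.univ ×ˢ U))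
    {z : E} (hz : z ∈ U) :
    HasFDerivAt (fun w => ∫ t in (0 : ℝ)..1, f (t, w))
      (∫ t in (0 : ℝ)..1, (fderiv ℝ f (t, z)).comp (ContinuousLinearMap.inr ℝ ℝ E)) z := by
  have hO : IsOpen ((Set.univ : Set ℝ) ×ˢ U) := isOpen_univ.prod hU
  have hd : ContinuousOn (fun p => (fderiv ℝ f p).comp (ContinuousLinearMap.inr ℝ ℝ E))
      (Set.univ ×ˢ U) :=
    (hf.continuousOn_fderiv_of_isOpen hO le_rfl).clm_comp continuousOn_const
  -- The derivative is bounded by some `C` on the compact segment `[0, 1] × {z}`, hence by `C + 1`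
  -- on an open set around it. The tube lemma finds in that set a product with a neighbourhood of
  -- `z`, where the constant `C + 1` dominates.
  have hK : IsCompact ((Set.Icc (0 : ℝ) 1) ×ˢ ({z} : Set E)) := isCompact_Icc.prod isCompact_singleton
  have hKO : (Set.Icc (0 : ℝ) 1) ×ˢ ({z} : Set E) ⊆ Set.univ ×ˢ U :=
    Set.prod_mono (Set.subset_univ _) (Set.singleton_subset_iff.2 hz)
  obtain ⟨C, hC⟩ := (hK.image_of_continuousOn (hd.mono hKO)).isBounded.exists_norm_le
  have hW : IsOpen {p | p ∈ (Set.univ : Set ℝ) ×ˢ U ∧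
      ‖(fderiv ℝ f p).comp (ContinuousLinearMap.inr ℝ ℝ E)‖ < C + 1} := by
    have := hd.norm.isOpen_inter_preimage hO (isOpen_Iio (a := C + 1))
    exact this
  have hKW : (Set.Icc (0 : ℝ) 1) ×ˢ ({z} : Set E) ⊆ {p | p ∈ (Set.univ : Set ℝ) ×ˢ U ∧
      ‖(fderiv ℝ f p).comp (ContinuousLinearMap.inr ℝ ℝ E)‖ < C + 1} := fun p hp =>
    ⟨hKO hp, lt_of_le_of_lt (hC _ ⟨p, hp, rfl⟩) (lt_add_one C)⟩
  obtain ⟨T, S, _, hS, hT, hzS, hTS⟩ := generalized_tube_lemma isCompact_Icc isCompact_singleton hW hKW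
  have hzS' : z ∈ S := hzS rfl
  refine intervalIntegral.hasFDerivAt_integral_of_dominated_of_fderiv_le (bound := fun _ => C + 1)
    (F := fun w t => f (t, w))
    (F' := fun w t => (fderiv ℝ f (t, w)).comp (ContinuousLinearMap.inr ℝ ℝ E))
    (hS.mem_nhds hzS') ?_ ?_ ?_ ?_ ?_ ?_
  · filter_upwards [hU.mem_nhds hz] with w hw
    exact (continuous_slice hf.continuousOn hw).aestronglyMeasurable
  · exact (continuous_slice hf.continuousOn hz).intervalIntegrable _ _
  · exact (continuous_slice hd hz).aestronglyMeasurable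
  · refine Filter.Eventually.of_forall fun t ht w hw => ?_
    rw [Set.uIoc_of_le zero_le_one] at ht
    exact (hTS (Set.mk_mem_prod (hT ⟨ht.1.le, ht.2⟩) hw)).2.le
  · exact intervalIntegrable_const
  · refine Filter.Eventually.of_forall fun t ht w hw => ?_
    rw [Set.uIoc_of_le zero_le_one] at ht
    have hm := (hTS (Set.mk_mem_prod (hT ⟨ht.1.le, ht.2⟩) hw)).1
    have h1 : HasFDerivAt f (fderiv ℝ f (t, w)) (t, w) :=
      ((hf.contDiffAt (hO.mem_nhds hm)).differentiableAt (by simp)).hasFDerivAt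
    exact h1.comp w (hasFDerivAt_prodMk_right t w)

/-- The derivative is again a parametric integral of a smooth integrand, now with values in `E →L[ℝ]
F`. The induction therefore has to vary `F`, which is why `E` and `F` share a universe. -/
theorem contDiffOn_integral_slice_nat (hU : IsOpen U) (n : ℕ)
    (hf : ContDiffOn ℝ ∞ f (Set.univ ×ˢ U)) :
    ContDiffOn ℝ n (fun w => ∫ t in (0 : ℝ)..1, f (t, w)) U := by
  induction n generalizing F with
  | zero =>
    refine contDiffOn_zero.2 fun z hz => ?_
    exact (hasFDerivAt_integral_slice hU (hf.of_le (by simp)) hz).continuousAt.continuousWithinAt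
  | succ n ih =>
    have hO : IsOpen ((Set.univ : Set ℝ) ×ˢ U) := isOpen_univ.prod hU
    have hd : ContDiffOn ℝ ∞ (fun p => (fderiv ℝ f p).comp (ContinuousLinearMap.inr ℝ ℝ E))
        (Set.univ ×ˢ U) :=
      (hf.fderiv_of_isOpen hO (by simp)).clm_comp contDiffOn_const
    have hD := fun z (hz : z ∈ U) => hasFDerivAt_integral_slice hU (hf.of_le (by simp)) hz
    push_cast
    rw [contDiffOn_succ_iff_fderiv_of_isOpen hU]
    refine ⟨fun z hz => (hD z hz).differentiableAt.differentiableWithinAt, by simp, ?_⟩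
    exact (ih hd).congr fun z hz => (hD z hz).fderiv

/-- A parametric integral over `[0, 1]` of a smooth integrand is smooth. -/
theorem contDiffOn_integral_slice (hU : IsOpen U) (hf : ContDiffOn ℝ ∞ f (Set.univ ×ˢ U)) :
    ContDiffOn ℝ ∞ (fun w => ∫ t in (0 : ℝ)..1, f (t, w)) U :=
  contDiffOn_infty.2 fun n => contDiffOn_integral_slice_nat hU n hf

end ParametricIntegral

/-! ### The homotopy formula on `ℝ × U` for an open subset `U` of a vector space. -/

section EuclideanHomotopy

open ContinuousAlternatingMap

variable {E : Type*} [NormedAddCommGroup E] [NormedSpace ℝ E]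

/-- Contraction of a 2-form on `ℝ × E` with `∂/∂t`, restricted to `E`. -/
def contractTime (E : Type*) [NormedAddCommGroup E] [NormedSpace ℝ E] :
    ((ℝ × E) [⋀^Fin 2]→L[ℝ] ℝ) →L[ℝ] (E [⋀^Fin 1]→L[ℝ] ℝ) :=
  (compContinuousLinearMapCLM (ContinuousLinearMap.inr ℝ ℝ E)).comp
    ((ContinuousLinearMap.apply ℝ _ ((1 : ℝ), (0 : E))).comp
      (curryLeftLI (𝕜 := ℝ) (E := ℝ × E) (F := ℝ) (n := 1)).toContinuousLinearMap)

theorem contractTime_apply (a : (ℝ × E) [⋀^Fin 2]→L[ℝ] ℝ) (v : Fin 1 → E) :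
    contractTime E a v = a ![(1, 0), (0, v 0)] := by
  change a (Matrix.vecCons _ _) = _
  congr 1
  ext i <;> fin_cases i <;> rfl

variable {Ω : ℝ × E → (ℝ × E) [⋀^Fin 2]→L[ℝ] ℝ} {U : Set E}

/-- Cartan's formula for a closed form: evaluating `dΩ = 0` on `∂/∂t, v 0, v 1` gives three terms,
one being the time derivative of `Ω` on `v 0, v 1` and the other two forming the exterior derivative
in the `E` directions of the contraction. -/
theorem extDeriv_contractTime {t : ℝ} {z : E}
    (hd : extDeriv Ω (t, z) = 0) :
    alternatizeUncurryFin
      ((contractTime E).comp ((fderiv ℝ Ω (t, z)).comp (ContinuousLinearMap.inr ℝ ℝ E))) =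
    (fderiv ℝ Ω (t, z) (1, 0)).compContinuousLinearMap (ContinuousLinearMap.inr ℝ ℝ E) := by
  ext v
  have h : extDeriv Ω (t, z) ![(1, 0), (0, v 0), (0, v 1)] = 0 := by rw [hd]; rfl
  rw [extDeriv, alternatizeUncurryFin_apply] at h
  rw [alternatizeUncurryFin_apply]
  rw [Fin.sum_univ_three] at h
  rw [Fin.sum_univ_two]
  have e0 : (0 : Fin 3).removeNth ![((1 : ℝ), (0 : E)), (0, v 0), (0, v 1)] =
      (fun i => ContinuousLinearMap.inr ℝ ℝ E (v i)) := by
    ext i <;> fin_cases i <;> rfl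
  have e1 : (1 : Fin 3).removeNth ![((1 : ℝ), (0 : E)), (0, v 0), (0, v 1)] =
      ![(1, 0), (0, v 1)] := by
    ext i <;> fin_cases i <;> rfl
  have e2 : (2 : Fin 3).removeNth ![((1 : ℝ), (0 : E)), (0, v 0), (0, v 1)] =
      ![(1, 0), (0, v 0)] := by
    ext i <;> fin_cases i <;> rfl
  rw [e0, e1, e2] at h
  simp only [ContinuousLinearMap.comp_apply, contractTime_apply] at h ⊢
  simp [Fin.removeNth] at h ⊢
  change _ = fderiv ℝ Ω (t, z) (1, 0) fun i => (0, v i)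
  linarith

theorem contDiffOn_integral_contractTime (hU : IsOpen U)
    (hΩ : ContDiffOn ℝ ∞ Ω (Set.univ ×ˢ U)) :
    ContDiffOn ℝ ∞ (fun w => ∫ t in (0 : ℝ)..1, contractTime E (Ω (t, w))) U :=
  contDiffOn_integral_slice (f := fun p => contractTime E (Ω p)) hU
    ((contractTime E).contDiff.comp_contDiffOn hΩ)

set_option maxSynthPendingDepth 3 in
/-- The homotopy formula for a closed 2-form on `ℝ × U`. -/
theorem extDeriv_integral_contractTime (hU : IsOpen U) (hΩ : ContDiffOn ℝ ∞ Ω (Set.univ ×ˢ U))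
    {z : E} (hz : z ∈ U) (hd : ∀ t : ℝ, extDeriv Ω (t, z) = 0) :
    extDeriv (fun w => ∫ t in (0 : ℝ)..1, contractTime E (Ω (t, w))) z =
      (Ω (1, z)).compContinuousLinearMap (ContinuousLinearMap.inr ℝ ℝ E) -
      (Ω (0, z)).compContinuousLinearMap (ContinuousLinearMap.inr ℝ ℝ E) := by
  have hO : IsOpen ((Set.univ : Set ℝ) ×ˢ U) := isOpen_univ.prod hU
  have hc : ContDiffOn ℝ ∞ (fun p => contractTime E (Ω p)) (Set.univ ×ˢ U) :=
    (contractTime E).contDiff.comp_contDiffOn hΩ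
  have hdiff : ∀ t : ℝ, DifferentiableAt ℝ Ω (t, z) := fun t =>
    (hΩ.contDiffAt (hO.mem_nhds ⟨Set.mem_univ t, hz⟩)).differentiableAt (by simp)
  have h1 := hasFDerivAt_integral_slice hU (hc.of_le (by simp)) hz
  have h2 : Continuous fun t : ℝ => (fderiv ℝ (fun p => contractTime E (Ω p)) (t, z)).comp
      (ContinuousLinearMap.inr ℝ ℝ E) :=
    continuous_slice (((hc.continuousOn_fderiv_of_isOpen hO (by simp))).clm_comp
      continuousOn_const) hz
  -- Alternatization is continuous and linear, so it passes under the integral. By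
  -- `extDeriv_contractTime` the integrand is then the time derivative of the restriction of `Ω` to
  -- `E`, and the fundamental theorem of calculus gives the two end terms.
  rw [extDeriv, h1.fderiv, ← alternatizeUncurryFinCLM_apply]
  refine (ContinuousLinearMap.intervalIntegral_comp_comm (alternatizeUncurryFinCLM ℝ E ℝ)
    (h2.intervalIntegrable _ _)).symm.trans ?_
  have h3 : ∀ t : ℝ, HasDerivAt
      (fun s => (Ω (s, z)).compContinuousLinearMap (ContinuousLinearMap.inr ℝ ℝ E))
      ((fderiv ℝ Ω (t, z) (1, 0)).compContinuousLinearMap (ContinuousLinearMap.inr ℝ ℝ E)) t :=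
    fun t => by
    have h4 : HasDerivAt (fun s => Ω (s, z)) (fderiv ℝ Ω (t, z) (1, 0)) t :=
      (hdiff t).hasFDerivAt.comp_hasDerivAt t ((hasDerivAt_id t).prodMk (hasDerivAt_const t z))
    exact (compContinuousLinearMapCLM (ContinuousLinearMap.inr ℝ ℝ E)).hasFDerivAt.comp_hasDerivAt
      t h4
  have h5 : Continuous fun t : ℝ => (fderiv ℝ Ω (t, z) (1, 0)).compContinuousLinearMap
      (ContinuousLinearMap.inr ℝ ℝ E) :=
    (compContinuousLinearMapCLM (ContinuousLinearMap.inr ℝ ℝ E)).continuous.comp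
      (continuous_slice ((hΩ.continuousOn_fderiv_of_isOpen hO (by simp)).clm_apply
        continuousOn_const) hz)
  rw [← intervalIntegral.integral_eq_sub_of_hasDerivAt (fun t _ => h3 t)
    (h5.intervalIntegrable _ _)]
  refine intervalIntegral.integral_congr fun t _ => ?_
  have h6 : fderiv ℝ (fun p => contractTime E (Ω p)) (t, z) =
      (contractTime E).comp (fderiv ℝ Ω (t, z)) :=
    ((contractTime E).hasFDerivAt.comp _ (hdiff t).hasFDerivAt).fderiv
  change alternatizeUncurryFin _ = _
  rw [h6]
  exact extDeriv_contractTime (hd t)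

end EuclideanHomotopy

end

/-! ### Forms that are smooth at a point, and pullback along maps defined well only locally. -/

noncomputable section

namespace DiffForm

open scoped Topology

section Local

variable {E M : Type*} [NormedAddCommGroup E] [NormedSpace ℝ E]
  [TopologicalSpace M] [ChartedSpace E M] {k : ℕ}

/-- The form `α` is smooth at `x`, in the preferred chart at `x`. -/
def SmoothAt (α : FormSection E M k) (x : M) : Prop :=
  ContDiffAt ℝ ∞ (inChart α x) (extChartAt 𝓘(ℝ, E) x x)

theorem smoothAt_of_mem {α : FormSection E M k} (hα : α ∈ smoothForms E M k) (x : M) :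
    SmoothAt α x :=
  contDiffAt_inChart hα x (mem_extChartAt_target x)

theorem SmoothAt.differentiableAt {α : FormSection E M k} {x : M} (h : SmoothAt α x) :
    DifferentiableAt ℝ (inChart α x) (extChartAt 𝓘(ℝ, E) x x) :=
  ContDiffAt.differentiableAt h (by simp)

theorem inChart_congr {α β : FormSection E M k} {x₀ : M} {y : E}
    (hy : y ∈ (extChartAt 𝓘(ℝ, E) x₀).target)
    (h : ∀ᶠ z in 𝓝 ((extChartAt 𝓘(ℝ, E) x₀).symm y), α z = β z) :
    inChart α x₀ =ᶠ[𝓝 y] inChart β x₀ := by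
  have hc : ContinuousAt (extChartAt 𝓘(ℝ, E) x₀).symm y :=
    (continuousOn_extChartAt_symm x₀).continuousAt ((isOpen_extChartAt_target x₀).mem_nhds hy)
  filter_upwards [hc.eventually h] with z hz
  simp only [inChart]
  rw [hz]

theorem inChart_congr_self {α β : FormSection E M k} {x : M} (h : ∀ᶠ z in 𝓝 x, α z = β z) :
    inChart α x =ᶠ[𝓝 (extChartAt 𝓘(ℝ, E) x x)] inChart β x :=
  inChart_congr (mem_extChartAt_target x) (by simpa using h)

theorem SmoothAt.congr {α β : FormSection E M k} {x : M} (hα : SmoothAt α x)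
    (h : ∀ᶠ z in 𝓝 x, β z = α z) : SmoothAt β x :=
  ContDiffAt.congr_of_eventuallyEq hα (inChart_congr_self h)

theorem SmoothAt.add {α β : FormSection E M k} {x : M} (hα : SmoothAt α x) (hβ : SmoothAt β x) :
    SmoothAt (α + β) x :=
  ContDiffAt.add hα hβ

theorem smoothAt_zero (x : M) : SmoothAt (0 : FormSection E M k) x :=
  smoothAt_of_mem (zero_mem _) x

theorem extD_add {α β : FormSection E M k} {x : M} (hα : SmoothAt α x) (hβ : SmoothAt β x) :
    extD (α + β) x = extD α x + extD β x := by
  simp only [extD, inChart_add]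
  rw [extDeriv_add hα.differentiableAt hβ.differentiableAt]
  rfl

theorem extD_const_smul (c : ℝ) (α : FormSection E M k) : extD (c • α) = c • extD α := by
  funext x
  simp only [extD, inChart_smul]
  rw [extDeriv_smul]
  rfl

theorem pull_id (α : FormSection E M k) : pull id α = α := by
  funext x
  ext v
  simp only [DiffForm.pull, mfderiv_id]
  rfl

variable {E' M' : Type*} [NormedAddCommGroup E'] [NormedSpace ℝ E']
  [TopologicalSpace M'] [ChartedSpace E' M']
variable [IsManifold 𝓘(ℝ, E) ∞ M] [IsManifold 𝓘(ℝ, E') ∞ M']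

theorem SmoothAt.smul {f : M → ℝ} {α : FormSection E M k} {x : M}
    (hf : ContMDiffAt 𝓘(ℝ, E) 𝓘(ℝ, ℝ) ∞ f x) (hα : SmoothAt α x) :
    SmoothAt (fun y => f y • α y) x := by
  have h : ContMDiffAt 𝓘(ℝ, E) 𝓘(ℝ, ℝ) ∞ (f ∘ (extChartAt 𝓘(ℝ, E) x).symm)
      (extChartAt 𝓘(ℝ, E) x x) := by
    refine ContMDiffAt.comp _ (by simpa using hf) ?_
    exact (contMDiffOn_extChartAt_symm x).contMDiffAt
      ((isOpen_extChartAt_target x).mem_nhds (mem_extChartAt_target x))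
  exact ContDiffAt.smul h.contDiffAt hα

/-- The local form of `inChart_pull`, for maps that are smooth near a point. -/
theorem inChart_pull_of_eventually {f : M → M'} {α : FormSection E' M' k}
    (x₀ : M) {y : E} (hy : y ∈ (extChartAt 𝓘(ℝ, E) x₀).target)
    (hf : ∀ᶠ z in 𝓝 ((extChartAt 𝓘(ℝ, E) x₀).symm y), ContMDiffAt 𝓘(ℝ, E) 𝓘(ℝ, E') ∞ f z) (q : M')
    (hq : f ((extChartAt 𝓘(ℝ, E) x₀).symm y) ∈ (extChartAt 𝓘(ℝ, E') q).source) :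
    ContDiffAt ℝ ∞ (extChartAt 𝓘(ℝ, E') q ∘ f ∘ (extChartAt 𝓘(ℝ, E) x₀).symm) y ∧
    inChart (pull f α) x₀ =ᶠ[nhds y] fun z =>
      (inChart α q
        ((extChartAt 𝓘(ℝ, E') q ∘ f ∘ (extChartAt 𝓘(ℝ, E) x₀).symm) z)).compContinuousLinearMap
        (fderiv ℝ (extChartAt 𝓘(ℝ, E') q ∘ f ∘ (extChartAt 𝓘(ℝ, E) x₀).symm) z) := by
  have key : ∀ z ∈ (extChartAt 𝓘(ℝ, E) x₀).target,
      ContMDiffAt 𝓘(ℝ, E) 𝓘(ℝ, E') ∞ f ((extChartAt 𝓘(ℝ, E) x₀).symm z) →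
      ContMDiffAt 𝓘(ℝ, E) 𝓘(ℝ, E') ∞ (f ∘ (extChartAt 𝓘(ℝ, E) x₀).symm) z := fun z hz hfz =>
    hfz.comp z ((contMDiffOn_extChartAt_symm x₀).contMDiffAt
      ((isOpen_extChartAt_target x₀).mem_nhds hz))
  have key2 : ∀ z ∈ (extChartAt 𝓘(ℝ, E) x₀).target,
      ContMDiffAt 𝓘(ℝ, E) 𝓘(ℝ, E') ∞ f ((extChartAt 𝓘(ℝ, E) x₀).symm z) →
      f ((extChartAt 𝓘(ℝ, E) x₀).symm z) ∈ (extChartAt 𝓘(ℝ, E') q).source →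
      ContMDiffAt 𝓘(ℝ, E) 𝓘(ℝ, E') ∞
        (extChartAt 𝓘(ℝ, E') q ∘ f ∘ (extChartAt 𝓘(ℝ, E) x₀).symm) z := fun z hz hfz hzq =>
    (contMDiffAt_extChartAt' (by simpa using hzq)).comp z (key z hz hfz)
  have hfy := hf.self_of_nhds
  refine ⟨(key2 y hy hfy hq).contDiffAt, ?_⟩
  have hc : ContinuousAt (extChartAt 𝓘(ℝ, E) x₀).symm y :=
    (continuousOn_extChartAt_symm x₀).continuousAt ((isOpen_extChartAt_target x₀).mem_nhds hy)
  filter_upwards [(isOpen_extChartAt_target (I := 𝓘(ℝ, E)) x₀).eventually_mem hy,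
    (key y hy hfy).continuousAt.preimage_mem_nhds ((isOpen_extChartAt_source q).mem_nhds hq),
    hc.eventually hf] with z hz hzq hfz
  have hF := (key2 z hz hfz hzq).mdifferentiableAt (by simp)
  have hψ : MDifferentiableAt 𝓘(ℝ, E) 𝓘(ℝ, E) (extChartAt 𝓘(ℝ, E) x₀).symm z :=
    ((contMDiffOn_extChartAt_symm (n := ∞) x₀).contMDiffAt
      ((isOpen_extChartAt_target x₀).mem_nhds hz)).mdifferentiableAt (by simp)
  have hχ : MDifferentiableAt 𝓘(ℝ, E') 𝓘(ℝ, E') (extChartAt 𝓘(ℝ, E') q).symm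
      ((extChartAt 𝓘(ℝ, E') q ∘ f ∘ (extChartAt 𝓘(ℝ, E) x₀).symm) z) :=
    ((contMDiffOn_extChartAt_symm (n := ∞) q).contMDiffAt
      ((isOpen_extChartAt_target q).mem_nhds
        ((extChartAt 𝓘(ℝ, E') q).map_source hzq))).mdifferentiableAt (by simp)
  have e1 := pull_pull (k := k) α (hfz.mdifferentiableAt (by simp)) hψ
  have e2 := pull_pull (k := k) α hχ hF
  have e3 : (f ∘ (extChartAt 𝓘(ℝ, E) x₀).symm) =ᶠ[nhds z]
      ((extChartAt 𝓘(ℝ, E') q).symm ∘ extChartAt 𝓘(ℝ, E') q ∘ f ∘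
        (extChartAt 𝓘(ℝ, E) x₀).symm) := by
    filter_upwards [(key z hz hfz).continuousAt.preimage_mem_nhds
      ((isOpen_extChartAt_source q).mem_nhds hzq)] with w hw
    exact ((extChartAt 𝓘(ℝ, E') q).left_inv hw).symm
  have e4 := (e1.trans (pull_congr α e3)).trans e2.symm
  rw [← mfderiv_eq_fderiv]
  exact e4

/-- The coefficients of the pullback contain the derivative of `f`, so `f` is taken smooth on a
neighbourhood. This covers maps such as fibre coordinates, which are smooth only on an open set. -/
theorem SmoothAt.pull {f : M → M'} {x : M} {α : FormSection E' M' k}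
    (hf : ∀ᶠ z in 𝓝 x, ContMDiffAt 𝓘(ℝ, E) 𝓘(ℝ, E') ∞ f z) (hα : SmoothAt α (f x)) :
    SmoothAt (pull f α : FormSection E M k) x := by
  obtain ⟨h1, h2⟩ := inChart_pull_of_eventually (α := α) x (mem_extChartAt_target x)
    (by simpa using hf) (f x) (by simp)
  refine ContDiffAt.congr_of_eventuallyEq ?_ h2
  refine contDiff_compCLM.contDiffAt.comp _ (ContDiffAt.prodMk ?_ (h1.fderiv_right (by simp)))
  refine ContDiffAt.comp (g := inChart α (f x)) _ ?_ h1
  simpa [SmoothAt] using hα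

/-- A form is smooth if it is smooth at each point in the preferred chart at that point. -/
theorem mem_smoothForms_of_smoothAt {α : FormSection E M k} (hα : ∀ x, SmoothAt α x) :
    α ∈ smoothForms E M k := by
  intro x₀ y hy
  -- Viewing `α` as its own pullback along the identity expresses its coefficients in the chart at
  -- `x₀` through those in the chart at the point itself, where smoothness is known.
  obtain ⟨h1, h2⟩ := inChart_pull_of_eventually (f := id) (α := α) x₀ hy
    (Filter.Eventually.of_forall fun z => contMDiffAt_id) ((extChartAt 𝓘(ℝ, E) x₀).symm y)
    (mem_extChartAt_source _)
  rw [pull_id] at h2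
  refine ContDiffAt.contDiffWithinAt (ContDiffAt.congr_of_eventuallyEq ?_ h2)
  refine contDiff_compCLM.contDiffAt.comp y (ContDiffAt.prodMk ?_ (h1.fderiv_right (by simp)))
  exact ContDiffAt.comp (g := inChart α ((extChartAt 𝓘(ℝ, E) x₀).symm y)) y (hα _) h1

/-- The exterior derivative commutes with pullback along a map that is smooth near the point. -/
theorem extD_pull_of_eventually {f : M → M'} {x : M} {α : FormSection E' M' k}
    (hf : ∀ᶠ z in 𝓝 x, ContMDiffAt 𝓘(ℝ, E) 𝓘(ℝ, E') ∞ f z) (hα : SmoothAt α (f x)) :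
    extD (DiffForm.pull f α : FormSection E M k) x = DiffForm.pull f (extD α) x := by
  obtain ⟨h1, h2⟩ := inChart_pull_of_eventually (α := α) x (mem_extChartAt_target x)
    (by simpa using hf) (f x) (by simp)
  have hq : (extChartAt 𝓘(ℝ, E') (f x) ∘ f ∘ (extChartAt 𝓘(ℝ, E) x).symm)
      (extChartAt 𝓘(ℝ, E) x x) = extChartAt 𝓘(ℝ, E') (f x) (f x) := by simp
  have hd : DifferentiableAt ℝ (inChart α (f x))
      ((extChartAt 𝓘(ℝ, E') (f x) ∘ f ∘ (extChartAt 𝓘(ℝ, E) x).symm)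
        (extChartAt 𝓘(ℝ, E) x x)) := by
    rw [hq]
    exact hα.differentiableAt
  have hφ : MDifferentiableAt 𝓘(ℝ, E) 𝓘(ℝ, E) (extChartAt 𝓘(ℝ, E) x) x :=
    mdifferentiableAt_extChartAt (mem_chart_source E x)
  have hχ : MDifferentiableAt 𝓘(ℝ, E') 𝓘(ℝ, E') (extChartAt 𝓘(ℝ, E') (f x)) (f x) :=
    mdifferentiableAt_extChartAt (mem_chart_source E' (f x))
  let β₀ : E' → E' [⋀^Fin (k + 1)]→L[ℝ] ℝ := extDeriv (inChart α (f x))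
  let β : FormSection E' E' (k + 1) := β₀
  have e1 := pull_pull (k := k + 1) β (h1.differentiableAt (by simp)).mdifferentiableAt hφ
  have e2 := pull_pull (k := k + 1) β hχ (hf.self_of_nhds.mdifferentiableAt (by simp))
  have e3 : ((extChartAt 𝓘(ℝ, E') (f x) ∘ f ∘ (extChartAt 𝓘(ℝ, E) x).symm) ∘
      extChartAt 𝓘(ℝ, E) x) =ᶠ[nhds x] (extChartAt 𝓘(ℝ, E') (f x) ∘ f) := by
    filter_upwards [(isOpen_extChartAt_source (I := 𝓘(ℝ, E)) x).mem_nhds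
      (mem_extChartAt_source x)] with w hw
    simp only [Function.comp_apply]
    rw [(extChartAt 𝓘(ℝ, E) x).left_inv hw]
  have e4 := (e1.trans (pull_congr β e3)).trans e2.symm
  have e5 := extDeriv_pullback (r := ∞) hd h1 (by simpa using ENat.LEInfty.out)
  have e6 := h2.extDeriv_eq.trans e5
  rw [← mfderiv_eq_fderiv] at e6
  change ContinuousAlternatingMap.compContinuousLinearMap
    (extDeriv (inChart (DiffForm.pull f α : FormSection E M k) x) (extChartAt 𝓘(ℝ, E) x x)) _ = _
  rw [e6]
  exact e4

end Local

section NormedSpace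

variable {E : Type*} [NormedAddCommGroup E] [NormedSpace ℝ E] {k : ℕ}

/-- The preferred charts of a vector space are the identity. This and `extD_self` let the Euclidean
formulas apply to forms pulled back to `ℝ × E`. -/
theorem inChart_self (α : FormSection E E k) (x₀ : E) : inChart α x₀ = α := by
  have h : ⇑(extChartAt 𝓘(ℝ, E) x₀).symm = id := by simp; rfl
  funext y
  have h1 := pull_congr (M := E) (E := E) α (x := y) (Filter.EventuallyEq.of_eq h)
  rw [pull_id] at h1
  exact h1

theorem extD_self (α : E → E [⋀^Fin k]→L[ℝ] ℝ) (x : E) :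
    extD (M := E) α x = extDeriv α x := by
  have h : ⇑(extChartAt 𝓘(ℝ, E) x) = id := by simp; rfl
  let β₀ : E → E [⋀^Fin (k + 1)]→L[ℝ] ℝ := extDeriv (inChart (M := E) α x)
  let β : FormSection E E (k + 1) := β₀
  have h1 := pull_congr (M := E) (E := E) β (x := x) (Filter.EventuallyEq.of_eq h)
  rw [pull_id] at h1
  have h2 : β₀ = extDeriv α := congrArg (extDeriv (𝕜 := ℝ)) (inChart_self (E := E) α x)
  exact h1.trans (congrFun h2 x)

end NormedSpace

end DiffForm

end

/-! ### The homotopy operator on manifolds. -/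

noncomputable section

namespace DiffForm

open scoped Topology

section Homotopy

/-- Maps of the form `id × A` fix `∂/∂t`, so contraction with it is natural for them. Charts of `M`
enter the homotopy in exactly this form. -/
theorem contractTime_comp_prodMap {E₁ E₂ : Type*} [NormedAddCommGroup E₁] [NormedSpace ℝ E₁]
    [NormedAddCommGroup E₂] [NormedSpace ℝ E₂] (a : (ℝ × E₂) [⋀^Fin 2]→L[ℝ] ℝ) (A : E₁ →L[ℝ] E₂) :
    contractTime E₁ (a.compContinuousLinearMap ((ContinuousLinearMap.id ℝ ℝ).prodMap A)) =
      (contractTime E₂ a).compContinuousLinearMap A := by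
  ext v
  rw [ContinuousAlternatingMap.compContinuousLinearMap_apply, contractTime_apply,
    contractTime_apply, ContinuousAlternatingMap.compContinuousLinearMap_apply]
  congr 1
  ext i <;> fin_cases i <;> simp

variable {E M : Type*} [NormedAddCommGroup E] [NormedSpace ℝ E]
  [TopologicalSpace M] [ChartedSpace E M]
  {E' M' : Type*} [NormedAddCommGroup E'] [NormedSpace ℝ E']
  [TopologicalSpace M'] [ChartedSpace E' M']

/-- The value of a form, as an alternating map on the model space. -/
def valueAt {k : ℕ} (α : FormSection E M k) (x : M) : E [⋀^Fin k]→L[ℝ] ℝ := α x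

/-- The derivative of the inverse of the chart at `x`, as a map on the model space. -/
def chartSymmDeriv (E : Type*) {M : Type*} [NormedAddCommGroup E] [NormedSpace ℝ E]
    [TopologicalSpace M] [ChartedSpace E M] (x : M) (z : E) : E →L[ℝ] E :=
  mfderiv 𝓘(ℝ, E) 𝓘(ℝ, E) (extChartAt 𝓘(ℝ, E) x).symm z

/-- The derivative at `y` of the chart at `x`, as a map on the model space. -/
def chartDeriv (E : Type*) {M : Type*} [NormedAddCommGroup E] [NormedSpace ℝ E]
    [TopologicalSpace M] [ChartedSpace E M] (x y : M) : E →L[ℝ] E :=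
  mfderiv 𝓘(ℝ, E) 𝓘(ℝ, E) (extChartAt 𝓘(ℝ, E) x) y

/-- The derivative of a homotopy `F` at `(t, y)`, on `ℝ × T_y M`. -/
def homotopyDeriv (F : ℝ × M → M') (p : ℝ × M) : (ℝ × E) →L[ℝ] E' :=
  mfderiv (𝓘(ℝ, ℝ).prod 𝓘(ℝ, E)) 𝓘(ℝ, E') F p

/-- The integrand of the homotopy operator. -/
def homotopyIntegrand (F : ℝ × M → M') (η : FormSection E' M' 2) (y : M) (t : ℝ) :
    E [⋀^Fin 1]→L[ℝ] ℝ :=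
  contractTime E ((valueAt η (F (t, y))).compContinuousLinearMap (homotopyDeriv F (t, y)))

/-- The homotopy operator `η ↦ ∫₀¹ ι_{∂t} F^* η dt` on 2-forms. -/
def homotopyForm (F : ℝ × M → M') (η : FormSection E' M' 2) : FormSection E M 1 := fun y =>
  (∫ t in (0 : ℝ)..1, homotopyIntegrand F η y t : E [⋀^Fin 1]→L[ℝ] ℝ)

/-- The homotopy `F` in the chart at `x`. -/
def homotopyInChart (F : ℝ × M → M') (x : M) (p : ℝ × E) : M' :=
  F (p.1, (extChartAt 𝓘(ℝ, E) x).symm p.2)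

variable {F : ℝ × M → M'} {V : Set M}

/-- The part of the chart at `x` that lies in `V`. -/
def chartRegion (E : Type*) {M : Type*} [NormedAddCommGroup E] [NormedSpace ℝ E]
    [TopologicalSpace M] [ChartedSpace E M] (V : Set M) (x : M) : Set E :=
  (extChartAt 𝓘(ℝ, E) x).target ∩ (extChartAt 𝓘(ℝ, E) x).symm ⁻¹' V

theorem isOpen_chartRegion (hV : IsOpen V) (x : M) : IsOpen (chartRegion E V x) :=
  (continuousOn_extChartAt_symm x).isOpen_inter_preimage (isOpen_extChartAt_target x) hV

theorem mem_chartRegion {x : M} (hx : x ∈ V) : extChartAt 𝓘(ℝ, E) x x ∈ chartRegion E V x :=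
  ⟨mem_extChartAt_target x, by simpa using hx⟩

variable [IsManifold 𝓘(ℝ, E) ∞ M]

theorem contMDiffOn_prod_symm (x : M) (V : Set M) :
    ContMDiffOn 𝓘(ℝ, ℝ × E) (𝓘(ℝ, ℝ).prod 𝓘(ℝ, E)) ∞
      (fun p : ℝ × E => (p.1, (extChartAt 𝓘(ℝ, E) x).symm p.2))
      (Set.univ ×ˢ chartRegion E V x) :=
  contDiff_fst.contMDiff.contMDiffOn.prodMk
    ((contMDiffOn_extChartAt_symm x).comp contDiff_snd.contMDiff.contMDiffOn fun _ hp => hp.2.1)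

theorem contMDiffOn_homotopyInChart
    (hF : ContMDiffOn (𝓘(ℝ, ℝ).prod 𝓘(ℝ, E)) 𝓘(ℝ, E') ∞ F (Set.univ ×ˢ V)) (x : M) :
    ContMDiffOn 𝓘(ℝ, ℝ × E) 𝓘(ℝ, E') ∞ (homotopyInChart F x) (Set.univ ×ˢ chartRegion E V x) :=
  hF.comp (contMDiffOn_prod_symm x V) fun _ hp => ⟨Set.mem_univ _, hp.2.2⟩

theorem eventually_contMDiffAt_homotopyInChart (hV : IsOpen V)
    (hF : ContMDiffOn (𝓘(ℝ, ℝ).prod 𝓘(ℝ, E)) 𝓘(ℝ, E') ∞ F (Set.univ ×ˢ V)) (x : M) (t : ℝ) {z : E}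
    (hz : z ∈ chartRegion E V x) :
    ∀ᶠ p in 𝓝 (t, z), ContMDiffAt 𝓘(ℝ, ℝ × E) 𝓘(ℝ, E') ∞ (homotopyInChart F x) p := by
  have hO : IsOpen ((Set.univ : Set ℝ) ×ˢ chartRegion E V x) :=
    isOpen_univ.prod (isOpen_chartRegion hV x)
  filter_upwards [hO.mem_nhds (Set.mk_mem_prod (Set.mem_univ t) hz)] with p hp
  exact (contMDiffOn_homotopyInChart hF x).contMDiffAt (hO.mem_nhds hp)

/-- The pullback of `η` along the homotopy in the chart at `x`, a form on `ℝ × E`. -/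
def homotopyPull (F : ℝ × M → M') (η : FormSection E' M' 2) (x : M) :
    ℝ × E → (ℝ × E) [⋀^Fin 2]→L[ℝ] ℝ :=
  (pull (homotopyInChart F x) η : FormSection (ℝ × E) (ℝ × E) 2)

variable {η : FormSection E' M' 2}

theorem contractTime_homotopyPull (hV : IsOpen V)
    (hF : ContMDiffOn (𝓘(ℝ, ℝ).prod 𝓘(ℝ, E)) 𝓘(ℝ, E') ∞ F (Set.univ ×ˢ V))
    (x : M) (t : ℝ) {z : E} (hz : z ∈ chartRegion E V x) :
    contractTime E (homotopyPull (E := E) F η x (t, z)) =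
      (homotopyIntegrand (E := E) F η ((extChartAt 𝓘(ℝ, E) x).symm z) t).compContinuousLinearMap
        (chartSymmDeriv E x z) := by
  have hψ : MDifferentiableAt 𝓘(ℝ, E) 𝓘(ℝ, E) (extChartAt 𝓘(ℝ, E) x).symm z :=
    ((contMDiffOn_extChartAt_symm (n := ∞) x).contMDiffAt
      ((isOpen_extChartAt_target x).mem_nhds hz.1)).mdifferentiableAt (by simp)
  have hFd : MDifferentiableAt (𝓘(ℝ, ℝ).prod 𝓘(ℝ, E)) 𝓘(ℝ, E') F
      (t, (extChartAt 𝓘(ℝ, E) x).symm z) :=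
    (hF.contMDiffAt ((isOpen_univ.prod hV).mem_nhds (Set.mk_mem_prod (Set.mem_univ t) hz.2))).mdifferentiableAt
      (by simp)
  have h1 : HasMFDerivAt 𝓘(ℝ, ℝ × E) (𝓘(ℝ, ℝ).prod 𝓘(ℝ, E))
      (fun p : ℝ × E => (p.1, (extChartAt 𝓘(ℝ, E) x).symm p.2)) (t, z)
      ((ContinuousLinearMap.id ℝ ℝ).prodMap (chartSymmDeriv E x z)) := by
    have h2 : HasMFDerivAt 𝓘(ℝ, ℝ × E) 𝓘(ℝ, ℝ) (fun p : ℝ × E => p.1) (t, z)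
        (ContinuousLinearMap.fst ℝ ℝ E) := hasFDerivAt_fst.hasMFDerivAt
    have h3 : HasMFDerivAt 𝓘(ℝ, ℝ × E) 𝓘(ℝ, E) (fun p : ℝ × E => p.2) (t, z)
        (ContinuousLinearMap.snd ℝ ℝ E) := hasFDerivAt_snd.hasMFDerivAt
    exact h2.prodMk (HasMFDerivAt.comp (t, z) hψ.hasMFDerivAt h3)
  have h4 := (HasMFDerivAt.comp (t, z) hFd.hasMFDerivAt h1).mfderiv
  rw [homotopyIntegrand, ← contractTime_comp_prodMap]
  congr 1
  change ContinuousAlternatingMap.compContinuousLinearMap _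
    (mfderiv 𝓘(ℝ, ℝ × E) 𝓘(ℝ, E') (F ∘ fun p : ℝ × E => (p.1, (extChartAt 𝓘(ℝ, E) x).symm p.2))
      (t, z)) = _
  rw [h4]
  rfl

theorem chartSymmDeriv_comp_chartDeriv {x y : M} (hy : y ∈ (extChartAt 𝓘(ℝ, E) x).source) :
    (chartSymmDeriv E x (extChartAt 𝓘(ℝ, E) x y)).comp (chartDeriv E x y) =
      ContinuousLinearMap.id ℝ E := by
  have hφ : MDifferentiableAt 𝓘(ℝ, E) 𝓘(ℝ, E) (extChartAt 𝓘(ℝ, E) x) y :=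
    mdifferentiableAt_extChartAt (by simpa using hy)
  have hψ : MDifferentiableAt 𝓘(ℝ, E) 𝓘(ℝ, E) (extChartAt 𝓘(ℝ, E) x).symm
      (extChartAt 𝓘(ℝ, E) x y) :=
    ((contMDiffOn_extChartAt_symm (n := ∞) x).contMDiffAt
      ((isOpen_extChartAt_target x).mem_nhds
        ((extChartAt 𝓘(ℝ, E) x).map_source hy))).mdifferentiableAt (by simp)
  have h : (extChartAt 𝓘(ℝ, E) x).symm ∘ extChartAt 𝓘(ℝ, E) x =ᶠ[𝓝 y] id := by
    filter_upwards [(isOpen_extChartAt_source (I := 𝓘(ℝ, E)) x).mem_nhds hy] with w hw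
    exact (extChartAt 𝓘(ℝ, E) x).left_inv hw
  have h1 := (mfderiv_comp y hψ hφ).symm.trans (h.mfderiv_eq.trans mfderiv_id)
  exact h1

/-- Restricting to the slice at time `t` and undoing the chart recovers the pullback along `F (t,
·)`. Times 0 and 1 give the end terms of the homotopy formula. -/
theorem homotopyPull_comp_inr (hV : IsOpen V)
    (hF : ContMDiffOn (𝓘(ℝ, ℝ).prod 𝓘(ℝ, E)) 𝓘(ℝ, E') ∞ F (Set.univ ×ˢ V))
    {x : M} (hx : x ∈ V) (t : ℝ) :
    ((homotopyPull (E := E) F η x (t, extChartAt 𝓘(ℝ, E) x x)).compContinuousLinearMap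
      (ContinuousLinearMap.inr ℝ ℝ E)).compContinuousLinearMap (chartDeriv E x x) =
    valueAt (pull (fun y => F (t, y)) η : FormSection E M 2) x := by
  have hφ : MDifferentiableAt 𝓘(ℝ, E) 𝓘(ℝ, E) (extChartAt 𝓘(ℝ, E) x) x :=
    mdifferentiableAt_extChartAt (mem_chart_source E x)
  have hi : HasMFDerivAt 𝓘(ℝ, E) 𝓘(ℝ, ℝ × E) (fun z : E => (t, z)) (extChartAt 𝓘(ℝ, E) x x)
      (ContinuousLinearMap.inr ℝ ℝ E) := (hasFDerivAt_prodMk_right t _).hasMFDerivAt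
  have hG := (eventually_contMDiffAt_homotopyInChart hV hF x t
    (mem_chartRegion hx)).self_of_nhds.mdifferentiableAt (by simp)
  have e1 := pull_pull (k := 2) η hG hi.mdifferentiableAt
  have e2 := pull_pull (k := 2) η (hG.comp _ hi.mdifferentiableAt) hφ
  have e3 : (homotopyInChart F x ∘ fun z : E => (t, z)) ∘ extChartAt 𝓘(ℝ, E) x =ᶠ[𝓝 x]
      fun y => F (t, y) := by
    filter_upwards [(isOpen_extChartAt_source (I := 𝓘(ℝ, E)) x).mem_nhds
      (mem_extChartAt_source x)] with w hw
    simp only [Function.comp_apply, homotopyInChart]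
    rw [(extChartAt 𝓘(ℝ, E) x).left_inv hw]
  have e4 := e2.trans (pull_congr η e3)
  refine Eq.trans ?_ e4
  have e5 : ((homotopyPull (E := E) F η x (t, extChartAt 𝓘(ℝ, E) x x)).compContinuousLinearMap
      (ContinuousLinearMap.inr ℝ ℝ E)) =
      (pull (homotopyInChart F x ∘ fun z : E => (t, z)) η : FormSection E E 2)
        (extChartAt 𝓘(ℝ, E) x x) := by
    refine Eq.trans ?_ e1
    rw [pull, hi.mfderiv]
    rfl
  rw [e5]
  rfl

variable [IsManifold 𝓘(ℝ, E') ∞ M']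

theorem contDiffOn_homotopyPull (hV : IsOpen V)
    (hF : ContMDiffOn (𝓘(ℝ, ℝ).prod 𝓘(ℝ, E)) 𝓘(ℝ, E') ∞ F (Set.univ ×ˢ V))
    (hη : η ∈ smoothForms E' M' 2) (x : M) :
    ContDiffOn ℝ ∞ (homotopyPull (E := E) F η x) (Set.univ ×ˢ chartRegion E V x) := by
  intro p hp
  have h : SmoothAt (pull (homotopyInChart F x) η : FormSection (ℝ × E) (ℝ × E) 2) p :=
    SmoothAt.pull (eventually_contMDiffAt_homotopyInChart hV hF x p.1 hp.2) (smoothAt_of_mem hη _)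
  rw [SmoothAt, inChart_self] at h
  have h' : extChartAt 𝓘(ℝ, ℝ × E) p p = p := by simp; rfl
  rw [h'] at h
  exact ContDiffAt.contDiffWithinAt h

theorem extDeriv_homotopyPull (hV : IsOpen V)
    (hF : ContMDiffOn (𝓘(ℝ, ℝ).prod 𝓘(ℝ, E)) 𝓘(ℝ, E') ∞ F (Set.univ ×ˢ V))
    (hη : η ∈ smoothForms E' M' 2) (hd : extD η = 0) (x : M) (t : ℝ) {z : E}
    (hz : z ∈ chartRegion E V x) :
    extDeriv (homotopyPull (E := E) F η x) (t, z) = 0 := by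
  rw [← extD_self]
  have h := extD_pull_of_eventually (α := η)
    (eventually_contMDiffAt_homotopyInChart hV hF x t hz) (smoothAt_of_mem hη _)
  rw [hd] at h
  exact h

/-- In the chart at `y` the integrand is a slice of a smooth form, and composing with the derivative
of the chart removes the chart again. Continuity makes the integral commute with continuous linear
maps. -/
theorem continuous_homotopyIntegrand (hV : IsOpen V)
    (hF : ContMDiffOn (𝓘(ℝ, ℝ).prod 𝓘(ℝ, E)) 𝓘(ℝ, E') ∞ F (Set.univ ×ˢ V))
    (hη : η ∈ smoothForms E' M' 2) {y : M} (hy : y ∈ V) :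
    Continuous (homotopyIntegrand (E := E) F η y) := by
  have h1 : Continuous fun t => (contractTime E (homotopyPull (E := E) F η y
      (t, extChartAt 𝓘(ℝ, E) y y))).compContinuousLinearMap (chartDeriv E y y) :=
    (ContinuousAlternatingMap.compContinuousLinearMapCLM (chartDeriv E y y)).continuous.comp
      ((contractTime E).continuous.comp
        (continuous_slice (contDiffOn_homotopyPull hV hF hη y).continuousOn (mem_chartRegion hy)))
  convert h1 using 2 with t
  rw [contractTime_homotopyPull hV hF y t (mem_chartRegion hy)]
  have h2 := chartSymmDeriv_comp_chartDeriv (E := E) (mem_extChartAt_source (I := 𝓘(ℝ, E)) y)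
  rw [extChartAt_to_inv]
  ext v
  have h3 : ∀ i, chartSymmDeriv E y (extChartAt 𝓘(ℝ, E) y y) (chartDeriv E y y (v i)) = v i :=
    fun i => DFunLike.congr_fun h2 (v i)
  simp only [ContinuousAlternatingMap.compContinuousLinearMap_apply]
  congr 1
  funext i
  exact (h3 i).symm

/-- At a fixed `z`, passing to the chart is a continuous linear operation and commutes with the
integral. Smoothness and the homotopy formula are thereby reduced to the Euclidean case. -/
theorem inChart_homotopyForm (hV : IsOpen V)
    (hF : ContMDiffOn (𝓘(ℝ, ℝ).prod 𝓘(ℝ, E)) 𝓘(ℝ, E') ∞ F (Set.univ ×ˢ V))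
    (hη : η ∈ smoothForms E' M' 2) (x : M) {z : E} (hz : z ∈ chartRegion E V x) :
    inChart (homotopyForm (E := E) F η) x z =
      ∫ t in (0 : ℝ)..1, contractTime E (homotopyPull (E := E) F η x (t, z)) := by
  have h := ContinuousLinearMap.intervalIntegral_comp_comm (μ := MeasureTheory.volume)
    (ContinuousAlternatingMap.compContinuousLinearMapCLM (chartSymmDeriv E x z) :
      (E [⋀^Fin 1]→L[ℝ] ℝ) →L[ℝ] (E [⋀^Fin 1]→L[ℝ] ℝ))
    ((continuous_homotopyIntegrand hV hF hη hz.2).intervalIntegrable 0 1)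
  refine h.symm.trans (intervalIntegral.integral_congr fun t _ => ?_)
  exact (contractTime_homotopyPull hV hF x t hz).symm

theorem smoothAt_homotopyForm (hV : IsOpen V)
    (hF : ContMDiffOn (𝓘(ℝ, ℝ).prod 𝓘(ℝ, E)) 𝓘(ℝ, E') ∞ F (Set.univ ×ˢ V))
    (hη : η ∈ smoothForms E' M' 2) {x : M} (hx : x ∈ V) :
    SmoothAt (homotopyForm (E := E) F η) x := by
  have hU := isOpen_chartRegion (E := E) hV x
  have h := contDiffOn_integral_contractTime hU (contDiffOn_homotopyPull hV hF hη x)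
  refine ContDiffAt.congr_of_eventuallyEq
    (h.contDiffAt (hU.mem_nhds (mem_chartRegion hx))) ?_
  filter_upwards [hU.mem_nhds (mem_chartRegion hx)] with z hz
  exact inChart_homotopyForm hV hF hη x hz

/-- The homotopy formula for a closed 2-form, on the open set where the homotopy is smooth. -/
theorem extD_homotopyForm (hV : IsOpen V)
    (hF : ContMDiffOn (𝓘(ℝ, ℝ).prod 𝓘(ℝ, E)) 𝓘(ℝ, E') ∞ F (Set.univ ×ˢ V))
    (hη : η ∈ smoothForms E' M' 2) (hd : extD η = 0) {x : M} (hx : x ∈ V) :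
    extD (homotopyForm (E := E) F η) x =
      (pull (fun y => F (1, y)) η : FormSection E M 2) x - pull (fun y => F (0, y)) η x := by
  have hU := isOpen_chartRegion (E := E) hV x
  have h1 : inChart (homotopyForm (E := E) F η) x =ᶠ[𝓝 (extChartAt 𝓘(ℝ, E) x x)]
      fun z => ∫ t in (0 : ℝ)..1, contractTime E (homotopyPull (E := E) F η x (t, z)) := by
    filter_upwards [hU.mem_nhds (mem_chartRegion hx)] with z hz
    exact inChart_homotopyForm hV hF hη x hz
  have h2 := h1.extDeriv_eq.trans (extDeriv_integral_contractTime hU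
    (contDiffOn_homotopyPull hV hF hη x) (mem_chartRegion hx)
    fun t => extDeriv_homotopyPull hV hF hη hd x t (mem_chartRegion hx))
  have h3 : valueAt (extD (homotopyForm (E := E) F η)) x =
      (extDeriv (inChart (homotopyForm (E := E) F η) x)
        (extChartAt 𝓘(ℝ, E) x x)).compContinuousLinearMap (chartDeriv E x x) := rfl
  rw [h2] at h3
  have h4 := homotopyPull_comp_inr (η := η) hV hF hx 1
  have h5 := homotopyPull_comp_inr (η := η) hV hF hx 0
  refine h3.trans ?_
  exact congrArg₂ (· - ·) h4 h5

end Homotopy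

end DiffForm

end

/-! ### Exact forms are smooth and closed. -/

noncomputable section

namespace DiffForm

open scoped Topology

section ExtD

variable {E M : Type*} [NormedAddCommGroup E] [NormedSpace ℝ E]
  [TopologicalSpace M] [ChartedSpace E M] [IsManifold 𝓘(ℝ, E) ∞ M] {k : ℕ}

/-- `extD` uses a different chart at each point. Since it commutes with pullback along the inverse
of one chart, that single chart computes it on its whole domain, which is needed to differentiate it
again. -/
theorem inChart_extD {α : FormSection E M k} (hα : α ∈ smoothForms E M k) (x₀ : M) {z : E}
    (hz : z ∈ (extChartAt 𝓘(ℝ, E) x₀).target) :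
    inChart (extD α) x₀ z = extDeriv (inChart α x₀) z := by
  have hf : ∀ᶠ w in 𝓝 z, ContMDiffAt 𝓘(ℝ, E) 𝓘(ℝ, E) ∞ (extChartAt 𝓘(ℝ, E) x₀).symm w := by
    filter_upwards [(isOpen_extChartAt_target (I := 𝓘(ℝ, E)) x₀).mem_nhds hz] with w hw
    exact (contMDiffOn_extChartAt_symm x₀).contMDiffAt ((isOpen_extChartAt_target x₀).mem_nhds hw)
  have h := extD_pull_of_eventually (α := α) hf (smoothAt_of_mem hα _)
  exact h.symm.trans (extD_self (inChart α x₀) z)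

theorem extD_mem {α : FormSection E M k} (hα : α ∈ smoothForms E M k) :
    extD α ∈ smoothForms E M (k + 1) := by
  intro x₀
  have ht := isOpen_extChartAt_target (I := 𝓘(ℝ, E)) x₀
  have h : ContDiffOn ℝ ∞ (inChart α x₀) (extChartAt 𝓘(ℝ, E) x₀).target := hα x₀
  have h1 : ContDiffOn ℝ ∞ (extDeriv (inChart α x₀)) (extChartAt 𝓘(ℝ, E) x₀).target :=
    (ContinuousAlternatingMap.alternatizeUncurryFinCLM ℝ E ℝ).contDiff.comp_contDiffOn
      (h.fderiv_of_isOpen ht (by simp))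
  exact h1.congr fun z hz => inChart_extD hα x₀ hz

theorem extD_extD {α : FormSection E M k} (hα : α ∈ smoothForms E M k) :
    extD (extD α) = 0 := by
  funext x
  have ht := (isOpen_extChartAt_target (I := 𝓘(ℝ, E)) x).mem_nhds (mem_extChartAt_target x)
  have h1 : inChart (extD α) x =ᶠ[𝓝 (extChartAt 𝓘(ℝ, E) x x)] extDeriv (inChart α x) := by
    filter_upwards [ht] with z hz
    exact inChart_extD hα x hz
  have h2 : extDeriv (inChart (extD α) x) (extChartAt 𝓘(ℝ, E) x x) = 0 :=
    h1.extDeriv_eq.trans (extDeriv_extDeriv_apply (smoothAt_of_mem hα x)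
      (by simpa using ENat.LEInfty.out))
  rw [extD, h2]
  rfl

end ExtD

end DiffForm

/-! ### Fibres, fibre coordinates and primitives over small open sets of the base. -/

namespace SymplecticBundle

open DiffForm
open scoped Topology

variable {EB EN EM B N M : Type*}
  [NormedAddCommGroup EB] [NormedSpace ℝ EB] [NormedAddCommGroup EN] [NormedSpace ℝ EN]
  [NormedAddCommGroup EM] [NormedSpace ℝ EM]
  [TopologicalSpace B] [ChartedSpace EB B] [TopologicalSpace N] [ChartedSpace EN N]
  [TopologicalSpace M] [ChartedSpace EM M]
  {π : M → B} {ωN : smoothForms EN N 2} {H : N → ℝ≥0}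

theorem contMDiff_proj (P : SymplecticBundle (EB := EB) (EM := EM) π ωN H) :
    ContMDiff 𝓘(ℝ, EM) 𝓘(ℝ, EB) ∞ π := by
  intro y
  obtain ⟨φ, hφ, hy⟩ := P.exists_mem (π y)
  have hs : φ.source ∈ 𝓝 y := φ.open_source.mem_nhds (φ.mem_source.2 hy)
  refine (contMDiffAt_fst.comp y ((P.contMDiffOn φ hφ).contMDiffAt hs)).congr_of_eventuallyEq ?_
  filter_upwards [hs] with z hz
  exact (φ.coe_fst hz).symm

variable (P : SymplecticBundle (EB := EB) (EM := EM) π ωN H)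

theorem contMDiffOn_fibreCoord {φ : Bundle.Trivialization N π} (hφ : φ ∈ P.atlas) :
    ContMDiffOn 𝓘(ℝ, EM) 𝓘(ℝ, EN) ∞ (fun y => (φ y).2) φ.source :=
  contMDiff_snd.comp_contMDiffOn (P.contMDiffOn φ hφ)

theorem eventually_contMDiffAt_fibreCoord {φ : Bundle.Trivialization N π} (hφ : φ ∈ P.atlas) {y : M}
    (hy : π y ∈ φ.baseSet) :
    ∀ᶠ z in 𝓝 y, ContMDiffAt 𝓘(ℝ, EM) 𝓘(ℝ, EN) ∞ (fun y => (φ y).2) z := by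
  filter_upwards [φ.open_source.mem_nhds (φ.mem_source.2 hy)] with z hz
  exact (P.contMDiffOn_fibreCoord hφ).contMDiffAt (φ.open_source.mem_nhds hz)

theorem proj_fibreMap {φ : Bundle.Trivialization N π} (hφ : φ ∈ P.atlas) {x : B}
    (hx : x ∈ φ.baseSet) (p : N) : π (P.fibreMap hφ hx p) = x :=
  φ.proj_symm_apply' hx

theorem fibreCoord_fibreMap {φ : Bundle.Trivialization N π} (hφ : φ ∈ P.atlas) {x : B}
    (hx : x ∈ φ.baseSet) (p : N) : (φ (P.fibreMap hφ hx p)).2 = p := by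
  change (φ (φ.toOpenPartialHomeomorph.symm (x, p))).2 = p
  rw [φ.apply_symm_apply' hx]

theorem pull_fibreMap_pull_fibreCoord {φ : Bundle.Trivialization N π} (hφ : φ ∈ P.atlas) {x : B}
    (hx : x ∈ φ.baseSet) {k : ℕ} (α : FormSection EN N k) :
    pull (P.fibreMap hφ hx) (pull (fun y => (φ y).2) α : FormSection EM M k) = α := by
  funext p
  have h1 := (P.eventually_contMDiffAt_fibreCoord hφ (y := P.fibreMap hφ hx p)
    (by rwa [P.proj_fibreMap])).self_of_nhds.mdifferentiableAt (by simp)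
  have h2 := pull_pull α h1 ((P.fibreMap hφ hx).contMDiff.mdifferentiable (by simp) p)
  have h3 : (fun y => (φ y).2) ∘ P.fibreMap hφ hx = id :=
    funext (P.fibreCoord_fibreMap hφ hx)
  rw [h3, pull_id] at h2
  exact h2

/-- A form that restricts to `ωN` on a fibre in one trivialisation does so in every one. -/
theorem pull_fibreMap_eq_of_eq {φ φ' : Bundle.Trivialization N π} (hφ : φ ∈ P.atlas)
    (hφ' : φ' ∈ P.atlas) {x : B} (hx : x ∈ φ.baseSet) (hx' : x ∈ φ'.baseSet)
    {α : FormSection EM M 2} (h : pull (P.fibreMap hφ hx) α = ωN.1) :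
    pull (P.fibreMap hφ' hx') α = ωN.1 := by
  obtain ⟨g, hg, hge⟩ := P.coordChange_mem φ' hφ' φ hφ x ⟨hx', hx⟩
  -- The two embeddings of the fibre differ by a transition map `g`, and `g` preserves `ωN`.
  have h1 : P.fibreMap hφ' hx' = P.fibreMap hφ hx ∘ g := by
    funext p
    rw [Function.comp_apply, hge]
    change φ'.toOpenPartialHomeomorph.symm (x, p) =
      φ.toOpenPartialHomeomorph.symm (x, (φ (φ'.toOpenPartialHomeomorph.symm (x, p))).2)
    have h2 : π (φ'.toOpenPartialHomeomorph.symm (x, p)) = x := φ'.proj_symm_apply' hx'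
    generalize φ'.toOpenPartialHomeomorph.symm (x, p) = q at h2
    rw [← h2]
    exact (φ.symm_apply_mk_proj (φ.mem_source.2 (by rwa [h2]))).symm
  funext p
  have h2 := pull_pull (g := g) α ((P.fibreMap hφ hx).contMDiff.mdifferentiable (by simp) (g p))
    (g.contMDiff.mdifferentiable (by simp) p)
  rw [h, hg.1] at h2
  rw [h2, h1]

/-- The homotopy on the part of `M` over a chart ball at `b` that contracts the base to `b`. -/
def contraction (π : M → B) (φ : Bundle.Trivialization N π) (b : B) (p : ℝ × M) : M :=
  φ.toOpenPartialHomeomorph.symm ((extChartAt 𝓘(ℝ, EB) b).symm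
    (extChartAt 𝓘(ℝ, EB) b b + Real.smoothTransition p.1 •
      (extChartAt 𝓘(ℝ, EB) b (π p.2) - extChartAt 𝓘(ℝ, EB) b b)), (φ p.2).2)

/-- `Real.smoothTransition` stays in `[0, 1]` for every real time, so convexity of the ball keeps
the homotopy inside the chart. It is thus smooth on all of `ℝ × π⁻¹(W)`, as the homotopy formula
requires, and not only for times in `[0, 1]`. -/
theorem contMDiffOn_contraction [IsManifold 𝓘(ℝ, EB) ∞ B] {φ : Bundle.Trivialization N π}
    (hφ : φ ∈ P.atlas) {b : B} {r : ℝ}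
    (hr : Metric.ball (extChartAt 𝓘(ℝ, EB) b b) r ⊆ (extChartAt 𝓘(ℝ, EB) b).target ∩
      (extChartAt 𝓘(ℝ, EB) b).symm ⁻¹' φ.baseSet) {W : Set B}
    (hW : W ⊆ (extChartAt 𝓘(ℝ, EB) b).source ∩
      extChartAt 𝓘(ℝ, EB) b ⁻¹' Metric.ball (extChartAt 𝓘(ℝ, EB) b b) r) (hWφ : W ⊆ φ.baseSet) :
    ContMDiffOn (𝓘(ℝ, ℝ).prod 𝓘(ℝ, EM)) 𝓘(ℝ, EM) ∞ (contraction (EB := EB) π φ b)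
      (Set.univ ×ˢ (π ⁻¹' W)) := by
  have hball : ∀ p ∈ (Set.univ : Set ℝ) ×ˢ (π ⁻¹' W),
      extChartAt 𝓘(ℝ, EB) b b + Real.smoothTransition p.1 •
        (extChartAt 𝓘(ℝ, EB) b (π p.2) - extChartAt 𝓘(ℝ, EB) b b) ∈
      Metric.ball (extChartAt 𝓘(ℝ, EB) b b) r := fun p hp => by
    have h1 : extChartAt 𝓘(ℝ, EB) b (π p.2) ∈ Metric.ball (extChartAt 𝓘(ℝ, EB) b b) r :=
      (hW hp.2).2
    have h0 : extChartAt 𝓘(ℝ, EB) b b ∈ Metric.ball (extChartAt 𝓘(ℝ, EB) b b) r :=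
      Metric.mem_ball_self (Metric.pos_of_mem_ball h1)
    exact (convex_ball _ _).add_smul_sub_mem h0 h1
      ⟨Real.smoothTransition.nonneg _, Real.smoothTransition.le_one _⟩
  have hπ : ContMDiffOn (𝓘(ℝ, ℝ).prod 𝓘(ℝ, EM)) 𝓘(ℝ, EB) ∞
      (fun p : ℝ × M => extChartAt 𝓘(ℝ, EB) b (π p.2)) (Set.univ ×ˢ (π ⁻¹' W)) :=
    contMDiffOn_extChartAt.comp (P.contMDiff_proj.comp contMDiff_snd).contMDiffOn
      fun p hp => by simpa using (hW hp.2).1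
  have hs : ContMDiffOn (𝓘(ℝ, ℝ).prod 𝓘(ℝ, EM)) 𝓘(ℝ, ℝ) ∞
      (fun p : ℝ × M => Real.smoothTransition p.1) (Set.univ ×ˢ (π ⁻¹' W)) :=
    (Real.smoothTransition.contDiff.contMDiff.comp contMDiff_fst).contMDiffOn
  have hc : ContMDiffOn (𝓘(ℝ, ℝ).prod 𝓘(ℝ, EM)) 𝓘(ℝ, EB) ∞
      (fun _ : ℝ × M => extChartAt 𝓘(ℝ, EB) b b) (Set.univ ×ˢ (π ⁻¹' W)) := contMDiffOn_const
  have hv := hc.add (hs.smul (hπ.sub hc))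
  have hx : ContMDiffOn (𝓘(ℝ, ℝ).prod 𝓘(ℝ, EM)) 𝓘(ℝ, EB) ∞
      (fun p : ℝ × M => (extChartAt 𝓘(ℝ, EB) b).symm
        (extChartAt 𝓘(ℝ, EB) b b + Real.smoothTransition p.1 •
          (extChartAt 𝓘(ℝ, EB) b (π p.2) - extChartAt 𝓘(ℝ, EB) b b)))
      (Set.univ ×ˢ (π ⁻¹' W)) :=
    (contMDiffOn_extChartAt_symm b).comp hv fun p hp => (hr (hball p hp)).1
  have hp2 : ContMDiffOn (𝓘(ℝ, ℝ).prod 𝓘(ℝ, EM)) 𝓘(ℝ, EN) ∞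
      (fun p : ℝ × M => (φ p.2).2) (Set.univ ×ˢ (π ⁻¹' W)) :=
    (P.contMDiffOn_fibreCoord hφ).comp contMDiff_snd.contMDiffOn
      fun p hp => φ.mem_source.2 (hWφ hp.2)
  exact (P.contMDiffOn_symm φ hφ).comp (hx.prodMk hp2)
    fun p hp => φ.mem_target.2 (hr (hball p hp)).2

/-- Over a small open set in the base, a closed 2-form that is cohomologous to `ωN` on each fibre
differs from the pullback of `ωN` by the derivative of a 1-form. -/
theorem exists_local_primitive [IsManifold 𝓘(ℝ, EB) ∞ B] [IsManifold 𝓘(ℝ, EN) ∞ N]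
    [IsManifold 𝓘(ℝ, EM) ∞ M] {η : FormSection EM M 2} (hη : η ∈ smoothForms EM M 2)
    (hd : extD η = 0)
    (hfib : ∀ (φ : Bundle.Trivialization N π) (hφ : φ ∈ P.atlas) (x : B) (hx : x ∈ φ.baseSet),
      ∃ θ ∈ smoothForms EN N 1, extD θ = pull (P.fibreMap hφ hx) η - ωN.1) (b : B) :
    ∃ W : Set B, IsOpen W ∧ b ∈ W ∧ ∃ lam : FormSection EM M 1, (∀ y, π y ∈ W → SmoothAt lam y) ∧
      ∃ φ ∈ P.atlas, W ⊆ φ.baseSet ∧ ∀ y, π y ∈ W →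
        extD lam y = η y - (pull (fun z => (φ z).2) ωN.1 : FormSection EM M 2) y := by
  obtain ⟨φ, hφ, hb⟩ := P.exists_mem b
  have hc : ContinuousOn (extChartAt 𝓘(ℝ, EB) b) (extChartAt 𝓘(ℝ, EB) b).source :=
    continuousOn_extChartAt b
  obtain ⟨r, hr0, hr⟩ := Metric.mem_nhds_iff.1
    (((continuousOn_extChartAt_symm (I := 𝓘(ℝ, EB)) b).isOpen_inter_preimage
      (isOpen_extChartAt_target b) φ.open_baseSet).mem_nhds
        ⟨mem_extChartAt_target b, by simpa using hb⟩)
  let W : Set B := (extChartAt 𝓘(ℝ, EB) b).source ∩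
      extChartAt 𝓘(ℝ, EB) b ⁻¹' Metric.ball (extChartAt 𝓘(ℝ, EB) b b) r
  have hWo : IsOpen W := hc.isOpen_inter_preimage (isOpen_extChartAt_source b) Metric.isOpen_ball
  have hWφ : W ⊆ φ.baseSet := fun x hx => by
    have h := (hr hx.2).2
    rwa [Set.mem_preimage, (extChartAt 𝓘(ℝ, EB) b).left_inv hx.1] at h
  have hV : IsOpen (π ⁻¹' W) := hWo.preimage P.contMDiff_proj.continuous
  have hF := P.contMDiffOn_contraction hφ hr (W := W) subset_rfl hWφ
  obtain ⟨θ, hθ, hdθ⟩ := hfib φ hφ b hb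
  have hF1 : ∀ y, π y ∈ W → contraction (EB := EB) π φ b (1, y) = y := fun y hy => by
    simp only [contraction, Real.smoothTransition.one, one_smul, add_sub_cancel]
    rw [(extChartAt 𝓘(ℝ, EB) b).left_inv hy.1]
    exact φ.symm_apply_mk_proj (φ.mem_source.2 (hWφ hy))
  have hF0 : (fun y => contraction (EB := EB) π φ b (0, y)) =
      P.fibreMap hφ hb ∘ fun y => (φ y).2 := by
    funext y
    simp only [contraction, Real.smoothTransition.zero, zero_smul, add_zero, extChartAt_to_inv]
    rfl
  -- At time 1 the contraction is the identity over `W`; at time 0 it is the fibre coordinate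
  -- followed by the embedding of the fibre over `b`. The first summand thus contributes `η` minus
  -- the pullback of `η` restricted to that fibre, and the summand from `θ` replaces this
  -- restriction by `ωN`.
  refine ⟨W, hWo, ⟨mem_extChartAt_source b, Metric.mem_ball_self hr0⟩,
    homotopyForm (contraction (EB := EB) π φ b) η + pull (fun z => (φ z).2) θ, fun y hy => ?_,
    φ, hφ, hWφ, fun y hy => ?_⟩
  · exact (smoothAt_homotopyForm hV hF hη hy).add
      (SmoothAt.pull (P.eventually_contMDiffAt_fibreCoord hφ (hWφ hy)) (smoothAt_of_mem hθ _))
  · have hpr := P.eventually_contMDiffAt_fibreCoord hφ (hWφ hy)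
    rw [extD_add (smoothAt_homotopyForm hV hF hη hy) (SmoothAt.pull hpr (smoothAt_of_mem hθ _)),
      extD_homotopyForm hV hF hη hd hy, extD_pull_of_eventually hpr (smoothAt_of_mem hθ _), hdθ,
      hF0, ← pull_pull η ((P.fibreMap hφ hb).contMDiff.mdifferentiable (by simp) _)
        (hpr.self_of_nhds.mdifferentiableAt (by simp))]
    have h1 : (fun y => contraction (EB := EB) π φ b (1, y)) =ᶠ[𝓝 y] id := by
      filter_upwards [hV.mem_nhds hy] with z hz
      exact hF1 z hz
    rw [pull_congr η h1, pull_id]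
    have h2 : (pull (fun z => (φ z).2) (pull (P.fibreMap hφ hb) η - ωN.1) : FormSection EM M 2) y =
      (pull (fun z => (φ z).2) (pull (P.fibreMap hφ hb) η) : FormSection EM M 2) y -
        (pull (fun z => (φ z).2) ωN.1 : FormSection EM M 2) y := rfl
    rw [h2]
    abel

end SymplecticBundle

end

/-! ### Gluing with a partition of unity, and compactness of sublevels. -/

noncomputable section

namespace SymplecticBundle

open DiffForm
open scoped Topology

variable {EB EN EM B N M : Type*}
  [NormedAddCommGroup EB] [NormedSpace ℝ EB] [NormedAddCommGroup EN] [NormedSpace ℝ EN]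
  [NormedAddCommGroup EM] [NormedSpace ℝ EM]
  [TopologicalSpace B] [ChartedSpace EB B] [TopologicalSpace N] [ChartedSpace EN N]
  [TopologicalSpace M] [ChartedSpace EM M]
  {π : M → B} {ωN : smoothForms EN N 2} {H : N → ℝ≥0}
  (P : SymplecticBundle (EB := EB) (EM := EM) π ωN H)

/-- The product of a form that is smooth over `W` with a bump function supported in `W`. -/
theorem smooth_bump_smul [IsManifold 𝓘(ℝ, EM) ∞ M] {k : ℕ} {W : Set B} {lam : FormSection EM M k}
    (hlam : ∀ y, π y ∈ W → SmoothAt lam y) {ρ : B → ℝ} (hρ : ContMDiff 𝓘(ℝ, EB) 𝓘(ℝ, ℝ) ∞ ρ)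
    (hW : tsupport ρ ⊆ W) (hπ : ContMDiff 𝓘(ℝ, EM) 𝓘(ℝ, EB) ∞ π) :
    (fun y => ρ (π y) • lam y : FormSection EM M k) ∈ smoothForms EM M k := by
  refine mem_smoothForms_of_smoothAt fun y => ?_
  -- Off the support of `ρ` the product vanishes locally, so the behaviour of `lam` outside `W`
  -- plays no part.
  by_cases hy : π y ∈ tsupport ρ
  · exact SmoothAt.smul (hρ.comp hπ).contMDiffAt (hlam y (hW hy))
  · refine (smoothAt_zero y).congr ?_
    have h := hπ.continuous.continuousAt.eventually (notMem_tsupport_iff_eventuallyEq.1 hy)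
    filter_upwards [h] with z hz
    rw [hz]
    exact zero_smul _ _

/-- The derivative of `(ρ ∘ π) • λ` on a fibre, where `dλ` is known over the support of `ρ`. -/
theorem pull_fibreMap_extD_bump_smul [IsManifold 𝓘(ℝ, EN) ∞ N] [IsManifold 𝓘(ℝ, EM) ∞ M]
    {W : Set B} {lam : FormSection EM M 1}
    (hlam : ∀ y, π y ∈ W → SmoothAt lam y) {ρ : B → ℝ} (hW : tsupport ρ ⊆ W)
    (hmu : (fun y => ρ (π y) • lam y : FormSection EM M 1) ∈ smoothForms EM M 1)
    {φ : Bundle.Trivialization N π} (hφ : φ ∈ P.atlas)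
    {x : B} (hx : x ∈ φ.baseSet) {β : FormSection EN N 2}
    (hβ : x ∈ W → pull (P.fibreMap hφ hx) (extD lam) = β) :
    pull (P.fibreMap hφ hx) (extD (fun y => ρ (π y) • lam y : FormSection EM M 1)) = ρ x • β := by
  rw [← extD_pull (P.fibreMap hφ hx).contMDiff hmu]
  -- `ρ ∘ π` is constant on a fibre. Restricting before differentiating therefore leaves no term in
  -- `dρ`.
  have h1 : (pull (P.fibreMap hφ hx) (fun y => ρ (π y) • lam y : FormSection EM M 1) :
      FormSection EN N 1) = ρ x • pull (P.fibreMap hφ hx) lam := by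
    funext p
    have h : ρ (π (P.fibreMap hφ hx p)) = ρ x := by rw [P.proj_fibreMap]
    simp only [pull]
    rw [h]
    rfl
  rw [h1, extD_const_smul]
  by_cases h0 : ρ x = 0
  · rw [h0, zero_smul, zero_smul]
  · have hxW : x ∈ W := hW (subset_tsupport ρ h0)
    rw [← hβ hxW]
    congr 1
    funext p
    exact extD_pull_of_eventually
      (Filter.Eventually.of_forall fun z => (P.fibreMap hφ hx).contMDiff.contMDiffAt)
      (hlam _ (by rwa [P.proj_fibreMap]))

/-- A closed 2-form whose restriction to each fibre is cohomologous to `ωN` can be changed within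
its class to a form that restricts to `ωN` on each fibre. -/
theorem exists_closed_extension [FiniteDimensional ℝ EB] [IsManifold 𝓘(ℝ, EB) ∞ B] [T2Space B]
    [CompactSpace B] [IsManifold 𝓘(ℝ, EN) ∞ N]
    [IsManifold 𝓘(ℝ, EM) ∞ M] {η : FormSection EM M 2} (hη : η ∈ smoothForms EM M 2)
    (hd : extD η = 0)
    (hfib : ∀ (φ : Bundle.Trivialization N π) (hφ : φ ∈ P.atlas) (x : B) (hx : x ∈ φ.baseSet),
      ∃ θ ∈ smoothForms EN N 1, extD θ = pull (P.fibreMap hφ hx) η - ωN.1) :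
    ∃ α ∈ smoothForms EM M 2, extD α = 0 ∧
      ∀ (φ : Bundle.Trivialization N π) (hφ : φ ∈ P.atlas) (x : B) (hx : x ∈ φ.baseSet),
        pull (P.fibreMap hφ hx) α = ωN.1 := by
  choose W hWo hbW lam hlam ψ hψ hWψ hdlam using P.exists_local_primitive hη hd hfib
  -- A finite subcover makes the partition of unity finite, so that the correction is a finite sum
  -- of smooth forms.
  obtain ⟨t, ht⟩ := isCompact_univ.elim_finite_subcover W hWo
    fun b _ => Set.mem_iUnion.2 ⟨b, hbW b⟩
  obtain ⟨ρ, hρ⟩ := SmoothPartitionOfUnity.exists_isSubordinate 𝓘(ℝ, EB) (s := Set.univ)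
    isClosed_univ (fun i : t => W i) (fun i => hWo i) fun x hx => by
      obtain ⟨b, hb, hxb⟩ := Set.mem_iUnion₂.1 (ht hx)
      exact Set.mem_iUnion.2 ⟨⟨b, hb⟩, hxb⟩
  let μ : t → FormSection EM M 1 := fun i y => ρ i (π y) • lam i y
  have hμ : ∀ i, μ i ∈ smoothForms EM M 1 := fun i =>
    smooth_bump_smul (hlam i) (ρ i).contMDiff (hρ i) P.contMDiff_proj
  have hsum : ∀ x, ∑ i, ρ i x = 1 := fun x => by
    rw [← finsum_eq_sum_of_fintype]
    exact ρ.sum_eq_one (Set.mem_univ x)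
  have hmem : ∑ i, extD (μ i) ∈ smoothForms EM M 2 := sum_mem fun i _ => extD_mem (hμ i)
  refine ⟨η - ∑ i, extD (μ i), sub_mem hη hmem, ?_, fun φ hφ x hx => ?_⟩
  · have h1 : d (⟨η, hη⟩ - ∑ i, ⟨extD (μ i), extD_mem (hμ i)⟩ : smoothForms EM M 2) = 0 := by
      rw [map_sub, map_sum]
      have h2 : d (⟨η, hη⟩ : smoothForms EM M 2) = 0 := hd
      have h3 : ∀ i, d (⟨extD (μ i), extD_mem (hμ i)⟩ : smoothForms EM M 2) = 0 := fun i =>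
        extD_extD (hμ i)
      simp only [h2, h3, Finset.sum_const_zero, sub_zero]
    have h4 : (⟨η, hη⟩ - ∑ i, ⟨extD (μ i), extD_mem (hμ i)⟩ : smoothForms EM M 2).1 =
        η - ∑ i, extD (μ i) := by simp
    rw [← h4]
    exact h1
  · have h1 : ∀ i : t, x ∈ W i → pull (P.fibreMap hφ hx) (extD (lam i)) =
        (pull (P.fibreMap hφ hx) η : FormSection EN N 2) - ωN.1 := fun i hi => by
      -- The local model is built from the trivialisation `ψ i`, while the fibre is embedded by `φ`;
      -- the symplectic transition maps reconcile the two.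
      have h2 : pull (P.fibreMap hφ hx) (pull (fun z => (ψ i z).2) ωN.1 : FormSection EM M 2) =
          ωN.1 :=
        P.pull_fibreMap_eq_of_eq (hψ i) hφ (hWψ i hi) hx
          (P.pull_fibreMap_pull_fibreCoord (hψ i) (hWψ i hi) ωN.1)
      conv_rhs => rw [← h2]
      funext p
      have h3 := hdlam i (P.fibreMap hφ hx p) (by rwa [P.proj_fibreMap])
      simp only [pull]
      rw [h3]
      rfl
    have h2 : ∀ i : t, pull (P.fibreMap hφ hx) (extD (μ i)) =
        ρ i x • ((pull (P.fibreMap hφ hx) η : FormSection EN N 2) - ωN.1) := fun i =>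
      P.pull_fibreMap_extD_bump_smul (hlam i) (hρ i) (hμ i) hφ hx (h1 i)
    have h3 : (pull (P.fibreMap hφ hx) (η - ∑ i, extD (μ i)) : FormSection EN N 2) =
        pull (P.fibreMap hφ hx) η - ∑ i, pull (P.fibreMap hφ hx) (extD (μ i)) := by
      let L : FormSection EM M 2 →+ FormSection EN N 2 :=
        { toFun := fun α => pull (P.fibreMap hφ hx) α
          map_zero' := rfl
          map_add' := fun _ _ => rfl }
      change L _ = L η - ∑ i, L _
      rw [map_sub, map_sum]
    rw [h3]
    simp only [h2]
    rw [← Finset.sum_smul, hsum, one_smul, sub_sub_cancel]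

/-- The sublevel sets of the height function lie in compact sets. -/
theorem exists_isCompact_sublevel_subset [LocallyCompactSpace B] [CompactSpace B]
    (hH : IsProperMap H) (R : ℝ) : ∃ C : Set M, IsCompact C ∧ P.sublevel R ⊆ C := by
  have hK : IsCompact (H ⁻¹' Set.Iic R.toNNReal) :=
    hH.isCompact_preimage (by rw [← Set.Icc_bot]; exact isCompact_Icc)
  choose φ hφ hb using P.exists_mem
  choose K hKc hKb hKφ using fun b => exists_compact_subset (φ b).open_baseSet (hb b)
  obtain ⟨t, ht⟩ := isCompact_univ.elim_finite_subcover (fun b => interior (K b))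
    (fun b => isOpen_interior) fun b _ => Set.mem_iUnion.2 ⟨b, hKb b⟩
  -- The sublevel is covered by finitely many trivialised pieces: a compact part of the base times
  -- the set `H ≤ R`, which is compact because `H` is proper.
  refine ⟨⋃ b ∈ t, (φ b).toOpenPartialHomeomorph.symm '' (K b ×ˢ (H ⁻¹' Set.Iic R.toNNReal)),
    t.isCompact_biUnion fun b _ => ((hKc b).prod hK).image_of_continuousOn
      ((φ b).toOpenPartialHomeomorph.continuousOn_symm.mono fun p hp =>
        (φ b).mem_target.2 (hKφ b hp.1)), fun y hy => ?_⟩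
  obtain ⟨b, hbt, hyb⟩ := Set.mem_iUnion₂.1 (ht (Set.mem_univ (π y)))
  have hyK : π y ∈ K b := interior_subset hyb
  refine Set.mem_iUnion₂.2 ⟨b, hbt, (π y, (φ b y).2), ⟨hyK, ?_⟩,
    (φ b).symm_apply_mk_proj ((φ b).mem_source.2 (hKφ b hyK))⟩
  have h1 : (P.height y : ℝ) ≤ R := hy
  rw [P.height_eq (hφ b) (hKφ b hyK)] at h1
  exact NNReal.le_toNNReal_of_coe_le h1

end SymplecticBundle

end

/-! ### Linear algebra of non-degenerate 2-forms. -/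

noncomputable section

section LinearAlgebra

open scoped Topology

variable {E : Type*} [NormedAddCommGroup E] [NormedSpace ℝ E]

/-- A non-degenerate alternating 2-form on a vector space. -/
def NondegenerateForm (a : E [⋀^Fin 2]→L[ℝ] ℝ) : Prop :=
  ∀ u : E, (∀ v : E, a ![u, v] = 0) → u = 0

theorem abs_apply_two_le (a : E [⋀^Fin 2]→L[ℝ] ℝ) (u v : E) : |a ![u, v]| ≤ ‖a‖ * (‖u‖ * ‖v‖) := by
  have h := a.le_opNorm ![u, v]
  rwa [Fin.prod_univ_two] at h

theorem apply_two_add_left (a : E [⋀^Fin 2]→L[ℝ] ℝ) (u u' v : E) :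
    a ![u + u', v] = a ![u, v] + a ![u', v] := by
  have h := (a.curryLeft).map_add u u'
  exact DFunLike.congr_fun h ![v]

theorem norm_curryLeft_apply_le (a : E [⋀^Fin 2]→L[ℝ] ℝ) (u : E) {D : ℝ} (hD : 0 ≤ D)
    (h : ∀ v, |a ![u, v]| ≤ D * ‖v‖) : ‖a.curryLeft u‖ ≤ D := by
  refine ContinuousAlternatingMap.opNorm_le_bound _ hD fun v => ?_
  have hv : v = ![v 0] := by ext i; fin_cases i; rfl
  rw [Fin.prod_univ_one]
  have h1 : a.curryLeft u v = a ![u, v 0] := by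
    rw [hv]; rfl
  rw [h1]
  exact h (v 0)

/-- Non-degenerate 2-forms are uniformly non-degenerate near a given one. -/
theorem NondegenerateForm.exists_lower_bound [FiniteDimensional ℝ E] {a : E [⋀^Fin 2]→L[ℝ] ℝ}
    (ha : NondegenerateForm a) :
    ∃ c > 0, ∀ᶠ a' in 𝓝 a, ∀ u : E, c * ‖u‖ ≤ ‖a'.curryLeft u‖ := by
  -- Non-degeneracy is injectivity of `u ↦ a(u, ·)`. In finite dimension an injective linear map is
  -- bounded below, here by `K⁻¹`; a perturbation of norm at most `K⁻¹ / 2` leaves half of that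
  -- bound.
  have hinj : LinearMap.ker (a.curryLeft : E →ₗ[ℝ] E [⋀^Fin 1]→L[ℝ] ℝ) = ⊥ := by
    rw [LinearMap.ker_eq_bot']
    intro u hu
    exact ha u fun v => DFunLike.congr_fun hu ![v]
  obtain ⟨K, hK, hL⟩ := LinearMap.exists_antilipschitzWith _ hinj
  have hK' : (0 : ℝ) < K := hK
  have hlow : ∀ u : E, (K : ℝ)⁻¹ * ‖u‖ ≤ ‖a.curryLeft u‖ := fun u => by
    have h := hL.le_mul_dist u 0
    simp only [dist_zero_right, map_zero] at h
    rw [inv_mul_le_iff₀ hK']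
    exact h
  refine ⟨(K : ℝ)⁻¹ / 2, by positivity, ?_⟩
  filter_upwards [Metric.ball_mem_nhds a (ε := (K : ℝ)⁻¹ / 2) (by positivity)] with a' ha' u
  have h1 : ‖a - a'‖ ≤ (K : ℝ)⁻¹ / 2 := by
    rw [← dist_eq_norm, dist_comm]
    exact (Metric.mem_ball.1 ha').le
  have h2 : ‖(a - a').curryLeft u‖ ≤ (K : ℝ)⁻¹ / 2 * ‖u‖ := by
    refine ((a - a').curryLeft.le_opNorm u).trans ?_
    rw [ContinuousAlternatingMap.norm_curryLeft]
    gcongr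
  have h3 : a.curryLeft u = (a - a').curryLeft u + a'.curryLeft u := by
    ext v
    exact (sub_add_cancel _ _).symm
  have h4 := hlow u
  rw [h3] at h4
  have h5 := norm_add_le ((a - a').curryLeft u) (a'.curryLeft u)
  linarith

variable {E₁ E₂ : Type*} [NormedAddCommGroup E₁] [NormedSpace ℝ E₁] [NormedAddCommGroup E₂]
  [NormedSpace ℝ E₂]

/-- Adding a large multiple of a non-degenerate form on the base to a form that is non-degenerate
on the fibres gives a non-degenerate form. -/
theorem nondegenerateForm_add_smul {a : (E₁ × E₂) [⋀^Fin 2]→L[ℝ] ℝ} {β : E₁ [⋀^Fin 2]→L[ℝ] ℝ}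
    {c₁ c₂ L K : ℝ} (hc₁ : 0 < c₁) (hc₂ : 0 < c₂) (hL : ‖a‖ ≤ L)
    (h₁ : ∀ w : E₂, c₁ * ‖w‖ ≤
      ‖(a.compContinuousLinearMap (ContinuousLinearMap.inr ℝ E₁ E₂)).curryLeft w‖)
    (h₂ : ∀ v : E₁, c₂ * ‖v‖ ≤ ‖β.curryLeft v‖) (hK : L * (1 + L / c₁) / c₂ < K) :
    NondegenerateForm
      (a + K • β.compContinuousLinearMap (ContinuousLinearMap.fst ℝ E₁ E₂)) := by
  have hL0 : 0 ≤ L := (norm_nonneg a).trans hL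
  have hK0 : 0 < K := lt_of_le_of_lt (by positivity) hK
  rintro ⟨v, w⟩ hu
  have hu' : ∀ v' w', a ![(v, w), (v', w')] + K * β ![v, v'] = 0 := fun v' w' => by
    have h := hu (v', w')
    have h1 : (β.compContinuousLinearMap (ContinuousLinearMap.fst ℝ E₁ E₂)) ![(v, w), (v', w')] =
        β ![v, v'] := by
      rw [ContinuousAlternatingMap.compContinuousLinearMap_apply]
      congr 1
      ext i; fin_cases i <;> rfl
    rw [← h1]
    exact h
  -- Pair a kernel vector `(v, w)` with vertical vectors `(0, w')`: the base form drops out, so `a`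
  -- on `w, w'` is minus `a` on `v, w'`. The horizontal part thus bounds the vertical one.
  have hw : c₁ * ‖w‖ ≤ L * ‖v‖ := by
    refine (h₁ w).trans (norm_curryLeft_apply_le _ _ (by positivity) fun w' => ?_)
    have h1 : (a.compContinuousLinearMap (ContinuousLinearMap.inr ℝ E₁ E₂)) ![w, w'] =
        a ![(0, w), (0, w')] := by
      rw [ContinuousAlternatingMap.compContinuousLinearMap_apply]
      congr 1
      ext i <;> fin_cases i <;> rfl
    have h2 := hu' 0 w'
    have h3 : β ![v, 0] = 0 := β.map_coord_zero 1 rfl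
    have h4 : a ![(v, w), (0, w')] = a ![(v, 0), (0, w')] + a ![(0, w), (0, w')] := by
      rw [← apply_two_add_left]; simp
    have h5 : a ![(0, w), (0, w')] = - a ![(v, 0), (0, w')] := by
      rw [h3, h4] at h2; linarith
    rw [h1, h5, abs_neg]
    refine (abs_apply_two_le a _ _).trans ?_
    simp only [Prod.norm_mk, norm_zero, norm_nonneg, sup_of_le_left, sup_of_le_right]
    rw [← mul_assoc]
    gcongr
  -- Pairing with `(v', 0)` gives `K β(v, v') = -a((v, w), (v', 0))`; the sup norm of `(v, w)` is at
  -- most `‖v‖ + ‖w‖`.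
  have hv : c₂ * ‖v‖ ≤ L * (‖v‖ + ‖w‖) / K := by
    refine (h₂ v).trans (norm_curryLeft_apply_le _ _ (by positivity) fun v' => ?_)
    have h1 : β ![v, v'] = - a ![(v, w), (v', 0)] / K := by
      rw [eq_div_iff hK0.ne']
      linarith [hu' v' 0]
    rw [h1, abs_div, abs_neg, abs_of_pos hK0, div_mul_eq_mul_div]
    gcongr
    refine (abs_apply_two_le a _ _).trans ?_
    simp only [Prod.norm_mk, norm_zero, norm_nonneg, sup_of_le_left]
    rw [← mul_assoc]
    gcongr
    exact max_le (by linarith [norm_nonneg w]) (by linarith [norm_nonneg v])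
  have hw' : ‖w‖ ≤ L / c₁ * ‖v‖ := by
    rw [div_mul_eq_mul_div, le_div_iff₀ hc₁]
    linarith
  -- Inserting the bound on `w` gives `c₂ K ‖v‖ ≤ L (1 + L / c₁) ‖v‖`, which the choice of `K` rules
  -- out unless `v = 0`.
  have hv0 : ‖v‖ = 0 := by
    by_contra hne
    have hpos : 0 < ‖v‖ := lt_of_le_of_ne (norm_nonneg v) (Ne.symm hne)
    rw [le_div_iff₀ hK0] at hv
    rw [div_lt_iff₀ hc₂] at hK
    have h1 : L * (‖v‖ + ‖w‖) ≤ L * (1 + L / c₁) * ‖v‖ := by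
      rw [mul_assoc]
      gcongr
      linarith
    have h2 : L * (1 + L / c₁) * ‖v‖ < K * c₂ * ‖v‖ := by gcongr
    linarith
  have hw0 : ‖w‖ = 0 := le_antisymm (by rw [hv0] at hw'; simpa using hw') (norm_nonneg w)
  rw [norm_eq_zero.1 hv0, norm_eq_zero.1 hw0]
  rfl

/-- The constants `c₁`, `c₂` and `L` of `nondegenerateForm_add_smul` can be kept fixed near `q`, and
with them the threshold for `K`. -/
theorem eventually_nondegenerateForm_add_smul {X : Type*} [TopologicalSpace X]
    [FiniteDimensional ℝ E₁] [FiniteDimensional ℝ E₂]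
    {a : X → (E₁ × E₂) [⋀^Fin 2]→L[ℝ] ℝ} {β : X → E₁ [⋀^Fin 2]→L[ℝ] ℝ} {q : X}
    (ha : ContinuousAt a q) (hβ : ContinuousAt β q)
    (h₁ : NondegenerateForm ((a q).compContinuousLinearMap (ContinuousLinearMap.inr ℝ E₁ E₂)))
    (h₂ : NondegenerateForm (β q)) :
    ∃ K₀ : ℝ, ∀ᶠ x in 𝓝 q, ∀ K ≥ K₀, NondegenerateForm
      (a x + K • (β x).compContinuousLinearMap (ContinuousLinearMap.fst ℝ E₁ E₂)) := by
  obtain ⟨c₁, hc₁, h₁'⟩ := h₁.exists_lower_bound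
  obtain ⟨c₂, hc₂, h₂'⟩ := h₂.exists_lower_bound
  have hv : ContinuousAt (fun x =>
      (a x).compContinuousLinearMap (ContinuousLinearMap.inr ℝ E₁ E₂)) q :=
    (ContinuousAlternatingMap.compContinuousLinearMapCLM
      (ContinuousLinearMap.inr ℝ E₁ E₂)).continuous.continuousAt.comp ha
  -- This is the threshold for `L = ‖a q‖ + 1`, a norm bound valid near `q`; the last `+ 1` turns `K
  -- ≥ K₀` into the strict inequality.
  refine ⟨(‖a q‖ + 1) * (1 + (‖a q‖ + 1) / c₁) / c₂ + 1, ?_⟩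
  filter_upwards [hv.eventually h₁', hβ.eventually h₂',
    ha.norm.eventually (gt_mem_nhds (lt_add_one ‖a q‖))] with x hx₁ hx₂ hx₃ K hK
  exact nondegenerateForm_add_smul hc₁ hc₂ hx₃.le hx₁ hx₂ (lt_of_lt_of_le (lt_add_one _) hK)

end LinearAlgebra

end

/-! ### Non-degeneracy on the total space. -/

noncomputable section

namespace DiffForm

open scoped Topology

variable {E M : Type*} [NormedAddCommGroup E] [NormedSpace ℝ E]
  [TopologicalSpace M] [ChartedSpace E M]

/-- The derivative of the inverse chart has a right inverse, so it is surjective, and by finite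
dimension also injective. Surjectivity reaches all test vectors; injectivity carries the conclusion
back. -/
theorem NondegenerateAt.inChart [IsManifold 𝓘(ℝ, E) ∞ M] [FiniteDimensional ℝ E] {α : FormSection E M 2} {x : M}
    (h : NondegenerateAt α x) : NondegenerateForm (inChart α x (extChartAt 𝓘(ℝ, E) x x)) := by
  have h1 := chartSymmDeriv_comp_chartDeriv (E := E) (mem_extChartAt_source (I := 𝓘(ℝ, E)) x)
  have hs : Function.Surjective (chartSymmDeriv E x (extChartAt 𝓘(ℝ, E) x x)) := fun v =>
    ⟨chartDeriv E x x v, DFunLike.congr_fun h1 v⟩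
  have hi : Function.Injective (chartSymmDeriv E x (extChartAt 𝓘(ℝ, E) x x)) :=
    (LinearMap.injective_iff_surjective
      (f := (chartSymmDeriv E x (extChartAt 𝓘(ℝ, E) x x) : E →ₗ[ℝ] E))).2 hs
  have hv : DiffForm.inChart α x (extChartAt 𝓘(ℝ, E) x x) = (valueAt α x).compContinuousLinearMap
      (chartSymmDeriv E x (extChartAt 𝓘(ℝ, E) x x)) := by
    have h2 : valueAt α ((extChartAt 𝓘(ℝ, E) x).symm (extChartAt 𝓘(ℝ, E) x x)) = valueAt α x := by
      rw [extChartAt_to_inv]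
    rw [← h2]
    rfl
  intro u hu
  refine hi ((h _ fun v => ?_).trans (map_zero (chartSymmDeriv E x _)).symm)
  obtain ⟨v, rfl⟩ := hs v
  have h3 := hu v
  rw [hv, ContinuousAlternatingMap.compContinuousLinearMap_apply] at h3
  refine Eq.trans ?_ h3
  change valueAt α x _ = _
  congr 1
  ext i
  fin_cases i <;> rfl

variable {E' M' : Type*} [NormedAddCommGroup E'] [NormedSpace ℝ E']
  [TopologicalSpace M'] [ChartedSpace E' M']

/-- If `G` has a right inverse near `y`, non-degeneracy of `G^* α` implies that of `α` at `y`. -/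
theorem nondegenerateAt_of_pull {α : FormSection E M 2} {G : E' → M} {Gi : M → E'} {y : M}
    (hG : MDifferentiableAt 𝓘(ℝ, E') 𝓘(ℝ, E) G (Gi y))
    (hGi : MDifferentiableAt 𝓘(ℝ, E) 𝓘(ℝ, E') Gi y) (h : G ∘ Gi =ᶠ[𝓝 y] id)
    (hα : NondegenerateForm (valueAt (pull G α : FormSection E' E' 2) (Gi y))) :
    NondegenerateAt α y := by
  let S : E' →L[ℝ] E := mfderiv 𝓘(ℝ, E') 𝓘(ℝ, E) G (Gi y)
  let T : E →L[ℝ] E' := mfderiv 𝓘(ℝ, E) 𝓘(ℝ, E') Gi y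
  have h1 : ∀ u : E, S (T u) = u := fun u =>
    DFunLike.congr_fun ((mfderiv_comp y hG hGi).symm.trans (h.mfderiv_eq.trans mfderiv_id)) u
  have hv : valueAt (pull G α : FormSection E' E' 2) (Gi y) =
      (valueAt α y).compContinuousLinearMap S := by
    have h2 : valueAt α (G (Gi y)) = valueAt α y := congrArg (valueAt α) h.self_of_nhds
    rw [← h2]
    rfl
  rw [hv] at hα
  intro u hu
  -- If `u` is in the kernel of `α`, then `T u` is in the kernel of the pullback because `S (T u) =
  -- u`. Only this one-sided inverse is needed; the dimensions of `E` and `E'` are not compared.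
  have hT : T u = 0 := hα _ fun v => by
    rw [ContinuousAlternatingMap.compContinuousLinearMap_apply]
    refine Eq.trans ?_ (hu (S v))
    change valueAt α y _ = valueAt α y _
    congr 1
    ext i
    fin_cases i
    · exact h1 u
    · rfl
  exact (h1 u).symm.trans ((congrArg S hT).trans (map_zero S))

end DiffForm

namespace SymplecticBundle

open DiffForm
open scoped Topology

variable {EB EN EM B N M : Type*}
  [NormedAddCommGroup EB] [NormedSpace ℝ EB] [NormedAddCommGroup EN] [NormedSpace ℝ EN]
  [NormedAddCommGroup EM] [NormedSpace ℝ EM]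
  [TopologicalSpace B] [ChartedSpace EB B] [TopologicalSpace N] [ChartedSpace EN N]
  [TopologicalSpace M] [ChartedSpace EM M]
  {π : M → B} {ωN : smoothForms EN N 2} {H : N → ℝ≥0}
  (P : SymplecticBundle (EB := EB) (EM := EM) π ωN H)

/-- The parametrisation of `M` near a point by charts of the base and of the fibre. -/
def bundleParam (EB EN : Type*) [NormedAddCommGroup EB] [NormedSpace ℝ EB] [NormedAddCommGroup EN]
    [NormedSpace ℝ EN] {B N M : Type*} [TopologicalSpace B] [ChartedSpace EB B]
    [TopologicalSpace N] [ChartedSpace EN N] [TopologicalSpace M] {π : M → B}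
    (φ : Bundle.Trivialization N π) (b : B) (p : N) (q : EB × EN) : M :=
  φ.toOpenPartialHomeomorph.symm
    ((extChartAt 𝓘(ℝ, EB) b).symm q.1, (extChartAt 𝓘(ℝ, EN) p).symm q.2)

/-- The domain of `bundleParam`. -/
def bundleParamDomain (EB EN : Type*) [NormedAddCommGroup EB] [NormedSpace ℝ EB]
    [NormedAddCommGroup EN] [NormedSpace ℝ EN] {B N M : Type*} [TopologicalSpace B]
    [ChartedSpace EB B] [TopologicalSpace N] [ChartedSpace EN N] [TopologicalSpace M] {π : M → B}
    (φ : Bundle.Trivialization N π) (b : B) (p : N) : Set (EB × EN) :=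
  chartRegion EB φ.baseSet b ×ˢ (extChartAt 𝓘(ℝ, EN) p).target

/-- The inverse of `bundleParam`. -/
def bundleCoord (EB EN : Type*) [NormedAddCommGroup EB] [NormedSpace ℝ EB] [NormedAddCommGroup EN]
    [NormedSpace ℝ EN] {B N M : Type*} [TopologicalSpace B] [ChartedSpace EB B]
    [TopologicalSpace N] [ChartedSpace EN N] [TopologicalSpace M] {π : M → B}
    (φ : Bundle.Trivialization N π) (b : B) (p : N) (y : M) : EB × EN :=
  (extChartAt 𝓘(ℝ, EB) b (π y), extChartAt 𝓘(ℝ, EN) p (φ y).2)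

theorem isOpen_bundleParamDomain (φ : Bundle.Trivialization N π) (b : B) (p : N) :
    IsOpen (bundleParamDomain EB EN φ b p) :=
  (isOpen_chartRegion φ.open_baseSet b).prod (isOpen_extChartAt_target p)

theorem contMDiffOn_bundleParam [IsManifold 𝓘(ℝ, EB) ∞ B] [IsManifold 𝓘(ℝ, EN) ∞ N]
    {φ : Bundle.Trivialization N π} (hφ : φ ∈ P.atlas) (b : B) (p : N) :
    ContMDiffOn 𝓘(ℝ, EB × EN) 𝓘(ℝ, EM) ∞ (bundleParam EB EN φ b p)
      (bundleParamDomain EB EN φ b p) := by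
  have h1 : ContMDiffOn 𝓘(ℝ, EB × EN) 𝓘(ℝ, EB) ∞
      (fun q : EB × EN => (extChartAt 𝓘(ℝ, EB) b).symm q.1) (bundleParamDomain EB EN φ b p) :=
    (contMDiffOn_extChartAt_symm b).comp contDiff_fst.contMDiff.contMDiffOn fun q hq => hq.1.1
  have h2 : ContMDiffOn 𝓘(ℝ, EB × EN) 𝓘(ℝ, EN) ∞
      (fun q : EB × EN => (extChartAt 𝓘(ℝ, EN) p).symm q.2) (bundleParamDomain EB EN φ b p) :=
    (contMDiffOn_extChartAt_symm p).comp contDiff_snd.contMDiff.contMDiffOn fun q hq => hq.2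
  exact (P.contMDiffOn_symm φ hφ).comp (h1.prodMk h2) fun q hq => φ.mem_target.2 hq.1.2

theorem proj_bundleParam (φ : Bundle.Trivialization N π) (b : B) (p : N) {q : EB × EN}
    (hq : q ∈ bundleParamDomain EB EN φ b p) :
    π (bundleParam EB EN φ b p q) = (extChartAt 𝓘(ℝ, EB) b).symm q.1 :=
  φ.proj_symm_apply' hq.1.2

theorem eventually_bundleCoord [IsManifold 𝓘(ℝ, EB) ∞ B] [IsManifold 𝓘(ℝ, EN) ∞ N]
    {φ : Bundle.Trivialization N π} (hφ : φ ∈ P.atlas) {y₀ : M} (hy₀ : π y₀ ∈ φ.baseSet) :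
    ∀ᶠ y in 𝓝 y₀, bundleCoord EB EN φ (π y₀) (φ y₀).2 y ∈
        bundleParamDomain EB EN φ (π y₀) (φ y₀).2 ∧
      bundleParam EB EN φ (π y₀) (φ y₀).2 (bundleCoord EB EN φ (π y₀) (φ y₀).2 y) = y ∧
      ContMDiffAt 𝓘(ℝ, EM) 𝓘(ℝ, EB × EN) ∞ (bundleCoord EB EN φ (π y₀) (φ y₀).2) y := by
  have hs := P.eventually_contMDiffAt_fibreCoord hφ hy₀
  have hπ := P.contMDiff_proj
  have h1 : ∀ᶠ y in 𝓝 y₀, π y ∈ (extChartAt 𝓘(ℝ, EB) (π y₀)).source :=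
    hπ.continuous.continuousAt.eventually (extChartAt_source_mem_nhds (π y₀))
  have h2 : ∀ᶠ y in 𝓝 y₀, (φ y).2 ∈ (extChartAt 𝓘(ℝ, EN) (φ y₀).2).source :=
    hs.self_of_nhds.continuousAt.eventually (extChartAt_source_mem_nhds (φ y₀).2)
  have h3 : ∀ᶠ y in 𝓝 y₀, π y ∈ φ.baseSet :=
    hπ.continuous.continuousAt.eventually (φ.open_baseSet.mem_nhds hy₀)
  filter_upwards [hs, h1, h2, h3] with y hy hy1 hy2 hy3
  have hl := (extChartAt 𝓘(ℝ, EB) (π y₀)).left_inv hy1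
  have hl2 := (extChartAt 𝓘(ℝ, EN) (φ y₀).2).left_inv hy2
  refine ⟨⟨⟨(extChartAt 𝓘(ℝ, EB) (π y₀)).map_source hy1, ?_⟩,
    (extChartAt 𝓘(ℝ, EN) (φ y₀).2).map_source hy2⟩, ?_, ?_⟩
  · simp only [Set.mem_preimage, bundleCoord]
    rwa [hl]
  · simp only [bundleParam, bundleCoord]
    rw [hl, hl2]
    exact φ.symm_apply_mk_proj (φ.mem_source.2 hy3)
  · have h4 : ContMDiffAt 𝓘(ℝ, EM) 𝓘(ℝ, EB) ∞ (fun z => extChartAt 𝓘(ℝ, EB) (π y₀) (π z)) y :=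
      (contMDiffAt_extChartAt' (by simpa using hy1)).comp y hπ.contMDiffAt
    have h5 : ContMDiffAt 𝓘(ℝ, EM) 𝓘(ℝ, EN) ∞
        (fun z => extChartAt 𝓘(ℝ, EN) (φ y₀).2 (φ z).2) y :=
      ContMDiffAt.comp (g := extChartAt 𝓘(ℝ, EN) (φ y₀).2) y
        (contMDiffAt_extChartAt' (by simpa using hy2)) hy
    exact h4.prodMk_space h5

/-- The pullback of `π^* ωB` along `bundleParam`. -/
theorem pull_bundleParam_pull_proj [IsManifold 𝓘(ℝ, EB) ∞ B] [IsManifold 𝓘(ℝ, EN) ∞ N]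
    {φ : Bundle.Trivialization N π} (hφ : φ ∈ P.atlas) (b : B) (p : N) (σ : FormSection EB B 2)
    {q : EB × EN} (hq : q ∈ bundleParamDomain EB EN φ b p) :
    valueAt (pull (bundleParam EB EN φ b p) (pull π σ : FormSection EM M 2) :
      FormSection (EB × EN) (EB × EN) 2) q =
    (inChart σ b q.1).compContinuousLinearMap (ContinuousLinearMap.fst ℝ EB EN) := by
  have ho := (isOpen_bundleParamDomain φ b p).mem_nhds hq
  have hG := ((P.contMDiffOn_bundleParam hφ b p).contMDiffAt ho).mdifferentiableAt (by simp)
  have hc : MDifferentiableAt 𝓘(ℝ, EB) 𝓘(ℝ, EB) (extChartAt 𝓘(ℝ, EB) b).symm q.1 :=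
    ((contMDiffOn_extChartAt_symm (n := ∞) b).contMDiffAt
      ((isOpen_extChartAt_target b).mem_nhds hq.1.1)).mdifferentiableAt (by simp)
  have hf : HasMFDerivAt 𝓘(ℝ, EB × EN) 𝓘(ℝ, EB) (fun q : EB × EN => q.1) q
      (ContinuousLinearMap.fst ℝ EB EN) := hasFDerivAt_fst.hasMFDerivAt
  have e1 := pull_pull (k := 2) σ (P.contMDiff_proj.mdifferentiable (by simp) _) hG
  have e2 := pull_pull (k := 2) σ hc hf.mdifferentiableAt
  have e3 : π ∘ bundleParam EB EN φ b p =ᶠ[𝓝 q]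
      (extChartAt 𝓘(ℝ, EB) b).symm ∘ fun q : EB × EN => q.1 := by
    filter_upwards [ho] with z hz
    exact proj_bundleParam φ b p hz
  have e4 := (e1.trans (pull_congr σ e3)).trans e2.symm
  refine Eq.trans e4 ?_
  rw [pull, hf.mfderiv]
  rfl

/-- The restriction to the fibre of the pullback along `bundleParam` of a form that restricts to
`ωN` on fibres. -/
theorem pull_bundleParam_comp_inr [IsManifold 𝓘(ℝ, EB) ∞ B] [IsManifold 𝓘(ℝ, EN) ∞ N]
    {φ : Bundle.Trivialization N π} (hφ : φ ∈ P.atlas) {b : B} (hb : b ∈ φ.baseSet) (p : N)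
    {α : FormSection EM M 2} (hα : pull (P.fibreMap hφ hb) α = ωN.1) :
    (valueAt (pull (bundleParam EB EN φ b p) α : FormSection (EB × EN) (EB × EN) 2)
      (extChartAt 𝓘(ℝ, EB) b b, extChartAt 𝓘(ℝ, EN) p p)).compContinuousLinearMap
        (ContinuousLinearMap.inr ℝ EB EN) = inChart ωN.1 p (extChartAt 𝓘(ℝ, EN) p p) := by
  have hq : (extChartAt 𝓘(ℝ, EB) b b, extChartAt 𝓘(ℝ, EN) p p) ∈ bundleParamDomain EB EN φ b p :=
    ⟨mem_chartRegion hb, mem_extChartAt_target p⟩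
  have ho := (isOpen_bundleParamDomain φ b p).mem_nhds hq
  have hG := ((P.contMDiffOn_bundleParam hφ b p).contMDiffAt ho).mdifferentiableAt (by simp)
  have hi : HasMFDerivAt 𝓘(ℝ, EN) 𝓘(ℝ, EB × EN) (fun w : EN => (extChartAt 𝓘(ℝ, EB) b b, w))
      (extChartAt 𝓘(ℝ, EN) p p) (ContinuousLinearMap.inr ℝ EB EN) :=
    (hasFDerivAt_prodMk_right _ _).hasMFDerivAt
  have hψ : MDifferentiableAt 𝓘(ℝ, EN) 𝓘(ℝ, EN) (extChartAt 𝓘(ℝ, EN) p).symm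
      (extChartAt 𝓘(ℝ, EN) p p) :=
    ((contMDiffOn_extChartAt_symm (n := ∞) p).contMDiffAt
      ((isOpen_extChartAt_target p).mem_nhds (mem_extChartAt_target p))).mdifferentiableAt (by simp)
  have e1 := pull_pull (k := 2) α hG hi.mdifferentiableAt
  have e2 := pull_pull (k := 2) α ((P.fibreMap hφ hb).contMDiff.mdifferentiable (by simp) _) hψ
  have e3 : (bundleParam EB EN φ b p ∘ fun w : EN => (extChartAt 𝓘(ℝ, EB) b b, w)) =
      P.fibreMap hφ hb ∘ (extChartAt 𝓘(ℝ, EN) p).symm := by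
    funext w
    simp only [Function.comp_apply, bundleParam, extChartAt_to_inv]
    rfl
  rw [e3, ← e2, hα] at e1
  refine Eq.trans ?_ e1
  rw [pull, hi.mfderiv]
  rfl

/-- Near each point of `M`, a form that restricts to `ωN` on fibres becomes non-degenerate after a
large multiple of `π^* ωB` is added. -/
theorem eventually_nondegenerateAt [FiniteDimensional ℝ EB] [FiniteDimensional ℝ EN]
    [IsManifold 𝓘(ℝ, EB) ∞ B] [IsManifold 𝓘(ℝ, EN) ∞ N] [IsManifold 𝓘(ℝ, EM) ∞ M]
    {ωB : smoothForms EB B 2} (hB : IsSymplectic ωB) (hN : IsSymplectic ωN)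
    {α : FormSection EM M 2} (hα : α ∈ smoothForms EM M 2)
    (hfib : ∀ (φ : Bundle.Trivialization N π) (hφ : φ ∈ P.atlas) (x : B) (hx : x ∈ φ.baseSet),
        pull (P.fibreMap hφ hx) α = ωN.1) (y₀ : M) :
    ∃ K₀ : ℝ, ∀ᶠ y in 𝓝 y₀, ∀ K ≥ K₀, NondegenerateAt (α + K • pull π ωB.1) y := by
  obtain ⟨φ, hφ, hb⟩ := P.exists_mem (π y₀)
  let G := bundleParam EB EN φ (π y₀) (φ y₀).2
  let Gi := bundleCoord EB EN φ (π y₀) (φ y₀).2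
  have hD := isOpen_bundleParamDomain (EB := EB) (EN := EN) φ (π y₀) (φ y₀).2
  have hGs := P.contMDiffOn_bundleParam hφ (π y₀) (φ y₀).2
  have hev := P.eventually_bundleCoord hφ hb
  obtain ⟨hq₀, hG₀, hGi₀⟩ := hev.self_of_nhds
  have hGev : ∀ q ∈ bundleParamDomain EB EN φ (π y₀) (φ y₀).2,
      ∀ᶠ z in 𝓝 q, ContMDiffAt 𝓘(ℝ, EB × EN) 𝓘(ℝ, EM) ∞ G z := fun q hq => by
    filter_upwards [hD.mem_nhds hq] with z hz
    exact hGs.contMDiffAt (hD.mem_nhds hz)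
  have hsm : SmoothAt (pull G α : FormSection (EB × EN) (EB × EN) 2) (Gi y₀) :=
    SmoothAt.pull (hGev _ hq₀) (smoothAt_of_mem hα _)
  have ha : ContinuousAt (fun q => valueAt (pull G α : FormSection (EB × EN) (EB × EN) 2) q)
      (Gi y₀) := by
    rw [SmoothAt, inChart_self] at hsm
    have h' : extChartAt 𝓘(ℝ, EB × EN) (Gi y₀) (Gi y₀) = Gi y₀ := by simp; rfl
    rw [h'] at hsm
    exact hsm.continuousAt
  have hβ : ContinuousAt (fun q : EB × EN => inChart ωB.1 (π y₀) q.1) (Gi y₀) :=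
    ContinuousAt.comp (f := Prod.fst) (x := Gi y₀)
      (smoothAt_of_mem ωB.2 (π y₀)).differentiableAt.continuousAt continuousAt_fst
  -- Vertical non-degeneracy is checked at the centre alone, where it is that of `ωN`; it spreads to
  -- nearby points by continuity.
  have h₁ : NondegenerateForm ((valueAt (pull G α : FormSection (EB × EN) (EB × EN) 2)
      (Gi y₀)).compContinuousLinearMap (ContinuousLinearMap.inr ℝ EB EN)) := by
    have h := P.pull_bundleParam_comp_inr hφ hb (φ y₀).2 (hfib φ hφ _ hb)
    have h' := (hN.nondegenerate (φ y₀).2).inChart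
    rw [← h] at h'
    exact h'
  obtain ⟨K₀, hK₀⟩ := eventually_nondegenerateForm_add_smul ha hβ h₁
    (hB.nondegenerate (π y₀)).inChart
  refine ⟨K₀, ?_⟩
  -- `eventually_nhds` supplies `G ∘ Gi = id` on a neighbourhood of each nearby `y`, so that it can
  -- be differentiated at `y`.
  filter_upwards [hGi₀.continuousAt.eventually hK₀, hev.eventually_nhds] with y hy hyev K hK
  obtain ⟨hq, -, hGi⟩ := hyev.self_of_nhds
  refine nondegenerateAt_of_pull (G := G) (Gi := Gi)
    ((hGev _ hq).self_of_nhds.mdifferentiableAt (by simp)) (hGi.mdifferentiableAt (by simp))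
    (hyev.mono fun z hz => hz.2.1) ?_
  have h1 := hy K hK
  rw [← P.pull_bundleParam_pull_proj hφ (π y₀) (φ y₀).2 ωB.1 hq] at h1
  exact h1

/-- Asking for all `K ≥ K₀`, and not for one `K`, makes the property stable under unions by taking
the maximum of two thresholds, so local thresholds combine over a compact set. -/
theorem exists_nondegenerateAt_on_sublevel [FiniteDimensional ℝ EB] [FiniteDimensional ℝ EN]
    [IsManifold 𝓘(ℝ, EB) ∞ B] [IsManifold 𝓘(ℝ, EN) ∞ N] [IsManifold 𝓘(ℝ, EM) ∞ M]
    {ωB : smoothForms EB B 2} (hB : IsSymplectic ωB) (hN : IsSymplectic ωN)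
    {α : FormSection EM M 2} (hα : α ∈ smoothForms EM M 2)
    (hfib : ∀ (φ : Bundle.Trivialization N π) (hφ : φ ∈ P.atlas) (x : B) (hx : x ∈ φ.baseSet),
        pull (P.fibreMap hφ hx) α = ωN.1) {C : Set M} (hC : IsCompact C) :
    ∃ K₀ : ℝ, ∀ y ∈ C, ∀ K ≥ K₀, NondegenerateAt (α + K • pull π ωB.1) y := by
  refine hC.induction_on (p := fun S => ∃ K₀ : ℝ, ∀ y ∈ S, ∀ K ≥ K₀,
    NondegenerateAt (α + K • pull π ωB.1) y) ⟨0, by simp⟩ ?_ ?_ ?_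
  · rintro S T hST ⟨K, hK⟩
    exact ⟨K, fun y hy => hK y (hST hy)⟩
  · rintro S T ⟨K, hK⟩ ⟨L, hL⟩
    refine ⟨max K L, fun y hy Q hQ => ?_⟩
    rcases hy with hy | hy
    · exact hK y hy Q ((le_max_left _ _).trans hQ)
    · exact hL y hy Q ((le_max_right _ _).trans hQ)
  · intro y₀ _
    obtain ⟨K₀, hK₀⟩ := P.eventually_nondegenerateAt hB hN hα hfib y₀
    exact ⟨_, mem_nhdsWithin_of_mem_nhds hK₀, K₀, fun y hy => hy⟩

/-- The pullback to a fibre of the pullback of a form on the base. -/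
theorem pull_fibreMap_pull_proj {φ : Bundle.Trivialization N π} (hφ : φ ∈ P.atlas) {x : B}
    (hx : x ∈ φ.baseSet) (σ : FormSection EB B 2) :
    (pull (P.fibreMap hφ hx) (pull π σ : FormSection EM M 2) : FormSection EN N 2) = 0 := by
  funext p
  have h1 := pull_pull (k := 2) σ (P.contMDiff_proj.mdifferentiable (by simp) _)
    ((P.fibreMap hφ hx).contMDiff.mdifferentiable (by simp) p)
  have h2 : π ∘ P.fibreMap hφ hx = fun _ => x := funext (P.proj_fibreMap hφ hx)
  rw [h1, h2, pull, mfderiv_const]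
  ext v
  exact (σ x).map_coord_zero 0 rfl

end SymplecticBundle

end

open DiffForm

theorem mainTheorem3
    {EB EN EM B N M : Type*}
    [NormedAddCommGroup EB] [NormedSpace ℝ EB] [FiniteDimensional ℝ EB]
    [NormedAddCommGroup EN] [NormedSpace ℝ EN] [FiniteDimensional ℝ EN]
    [NormedAddCommGroup EM] [NormedSpace ℝ EM] [FiniteDimensional ℝ EM]
    [TopologicalSpace B] [ChartedSpace EB B] [IsManifold 𝓘(ℝ, EB) ∞ B] [T2Space B]
    [CompactSpace B]
    [TopologicalSpace N] [ChartedSpace EN N] [IsManifold 𝓘(ℝ, EN) ∞ N] [T2Space N]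
    [TopologicalSpace M] [ChartedSpace EM M] [IsManifold 𝓘(ℝ, EM) ∞ M] [T2Space M]
    (ωB : DiffForm.smoothForms EB B 2) (_hB : DiffForm.IsSymplectic ωB)
    (ωN : DiffForm.smoothForms EN N 2) (hN : DiffForm.IsSymplectic ωN)
    (H : N → ℝ≥0) (_hH : IsProperMap H)
    (π : M → B) (P : SymplecticBundle (EB := EB) (EM := EM) π ωN H)
    (e : DiffForm.DeRham EM M 2)
    (_he : ∀ (φ : Bundle.Trivialization N π) (hφ : φ ∈ P.atlas) (x : B) (hx : x ∈ φ.baseSet),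
      DiffForm.cohomologyMap 2 (P.fibreMap hφ hx) e = hN.cohomologyClass)
    (R : ℝ) (_hR : 0 < R) :
    ∃ ωM : DiffForm.smoothForms EM M 2,
      ωM ∈ DiffForm.closedForms EM M 2 ∧
      (∀ y ∈ P.sublevel R, DiffForm.NondegenerateAt ωM.1 y) ∧
      ∀ (φ : Bundle.Trivialization N π) (hφ : φ ∈ P.atlas) (x : B) (hx : x ∈ φ.baseSet),
        DiffForm.pullback (P.fibreMap hφ hx) ωM = ωN := by
  obtain ⟨⟨η, hη⟩, rfl⟩ := Submodule.Quotient.mk_surjective _ e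
  have hfib : ∀ (φ : Bundle.Trivialization N π) (hφ : φ ∈ P.atlas) (x : B) (hx : x ∈ φ.baseSet),
      ∃ θ ∈ smoothForms EN N 1, extD θ = pull (P.fibreMap hφ hx) η.1 - ωN.1 := by
    intro φ hφ x hx
    -- Equality of classes in the quotient says that the difference of the representatives is exact.
    obtain ⟨θ, hθ⟩ := (Submodule.Quotient.eq _).1 (_he φ hφ x hx)
    exact ⟨θ.1, θ.2, hθ⟩
  obtain ⟨α, hα, hdα, hαfib⟩ := P.exists_closed_extension η.2 hη hfib
  have : LocallyCompactSpace B := ChartedSpace.locallyCompactSpace EB B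
  obtain ⟨C, hC, hRC⟩ := P.exists_isCompact_sublevel_subset _hH R
  obtain ⟨K, hK⟩ := P.exists_nondegenerateAt_on_sublevel _hB hN hα hαfib hC
  let πs : C^∞⟮𝓘(ℝ, EM), M; 𝓘(ℝ, EB), B⟯ := ⟨π, P.contMDiff_proj⟩
  -- The added term vanishes on every fibre, so `K` can be taken as large as non-degeneracy demands.
  refine ⟨⟨α, hα⟩ + K • pullback πs ωB, ?_, fun y hy => hK y (hRC hy) K le_rfl,
    fun φ hφ x hx => ?_⟩
  · exact add_mem (show (⟨α, hα⟩ : smoothForms EM M 2) ∈ closedForms EM M 2 from hdα)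
      (Submodule.smul_mem _ _ (pullback_mem_closedForms πs ωB _hB.closed))
  · rw [map_add, map_smul]
    have h1 : pullback (P.fibreMap hφ hx) ⟨α, hα⟩ = ωN := Subtype.ext (hαfib φ hφ x hx)
    have h2 : pullback (P.fibreMap hφ hx) (pullback πs ωB) = 0 :=
      Subtype.ext (P.pull_fibreMap_pull_proj hφ hx ωB.1)
    rw [h1, h2, smul_zero, add_zero]
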